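/- Let $(X_j,d_j)$ be a nonempty compact metric space and $Y_j$ a compact Hausdorff space for $j=1,2$, and let $C(Y_j)$ be the space of complex-valued continuous functions on $Y_j$ with the supremum norm. For $0<\alpha\le 1$ and a continuous map $F:X_j\to C(Y_j)$ put $\|F\|_\infty=\sup_{x\in X_j}\|F(x)\|$ and $$L_\alpha(F)=\sup_{x\ne x'}\frac{\|F(x)-F(x')\|}{d_j(x,x')^\alpha}$$ (the supremum of the empty set being $0$), and write $L=L_1$. Let $\mathrm{Lip}(X_j,C(Y_j))$ be the space of all continuous $F:X_j\to C(Y_j)$ with $L(F)<\infty$. For $0<\alpha<1$ let $\mathrm{lip}_\alpha(X_j,C(Y_j))$ be the space of all continuous $F:X_j\to C(Y_j)$ with $L_\alpha(F)<\infty$ and $$\lim_{x\to x_0}\frac{\|F(x_0)-F(x)\|}{d_j(x_0,x)^\alpha}=0\qquad\text{for every }x_0\in X_j.$$ Write $F(x,y)=(F(x))(y)$. Then a map $U:\mathrm{Lip}(X_1,C(Y_1))\to\mathrm{Lip}(X_2,C(Y_2))$ is a surjective complex-linear isometry with respect to the norms $\|\cdot\|_\infty+L(\cdot)$ if and only if there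 exist $h\in C(Y_2)$ with $|h|=1$ on $Y_2$, a continuous map $\varphi:X_2\times Y_2\to X_1$ such that $\varphi(\cdot,y):X_2\to X_1$ is a surjective isometry for every $y\in Y_2$, and a homeomorphism $\tau:Y_2\to Y_1$ such that $$U(F)(x,y)=h(y)\,F(\varphi(x,y),\tau(y)),\qquad (x,y)\in X_2\times Y_2,$$ for every $F\in\mathrm{Lip}(X_1,C(Y_1))$. Likewise, for every $0<\alpha<1$, a map $U:\mathrm{lip}_\alpha(X_1,C(Y_1))\to\mathrm{lip}_\alpha(X_2,C(Y_2))$ is a surjective complex-linear isometry with respect to the norms $\|\cdot\|_\infty+L_\alpha(\cdot)$ if and only if there exist $h$, $\varphi$, $\tau$ as above such that the same formula holds for every $F\in\mathrm{lip}_\alpha(X_1,C(Y_1))$. -/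

import Mathlib

open Set Filter Topology

/-- The set of difference quotients `‖F x - F y‖ / d(x, y) ^ α`, over `x ≠ y`. -/
def lipQuotients {K E : Type*} [MetricSpace K] [NormedAddCommGroup E]
    (α : ℝ) (F : C(K, E)) : Set ℝ :=
  {r | ∃ x y : K, x ≠ y ∧ r = ‖F x - F y‖ / dist x y ^ α}

/-- The `α`-Lipschitz number `L_α(F)`: the supremum of the difference quotients. It is used only
for maps whose difference quotients are bounded above (`L_α(F) < ∞`); it is `0` when `K` has at
most one point. -/
noncomputable def lipNumber {K E : Type*} [MetricSpace K] [NormedAddCommGroup E]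
    (α : ℝ) (F : C(K, E)) : ℝ :=
  sSup (lipQuotients α F)

/-- The Lipschitz space `Lip_α(K, E)`: the continuous maps with `L_α(F) < ∞`. -/
def LipSpace (α : ℝ) (K E : Type*) [MetricSpace K] [NormedAddCommGroup E] [NormedSpace ℂ E] :
    Submodule ℂ C(K, E) where
  carrier := {F | BddAbove (lipQuotients α F)}
  zero_mem' := by
    refine ⟨0, ?_⟩
    rintro r ⟨x, y, -, rfl⟩
    simp
  add_mem' := by
    rintro F G ⟨A, hA⟩ ⟨B, hB⟩
    refine ⟨A + B, ?_⟩
    rintro r ⟨x, y, hxy, rfl⟩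
    have h1 := hA ⟨x, y, hxy, rfl⟩
    have h2 := hB ⟨x, y, hxy, rfl⟩
    refine le_trans ?_ (add_le_add h1 h2)
    rw [← add_div]
    refine div_le_div_of_nonneg_right ?_ (Real.rpow_nonneg dist_nonneg α)
    simp only [ContinuousMap.add_apply]
    rw [add_sub_add_comm]
    exact norm_add_le _ _
  smul_mem' := by
    rintro c F ⟨A, hA⟩
    refine ⟨‖c‖ * A, ?_⟩
    rintro r ⟨x, y, hxy, rfl⟩
    have h1 := hA ⟨x, y, hxy, rfl⟩
    simp only [ContinuousMap.smul_apply]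
    rw [← smul_sub, norm_smul, mul_div_assoc]
    exact mul_le_mul_of_nonneg_left h1 (norm_nonneg c)

/-- The little Lipschitz space `lip_α(K, E)`: the maps `F` in `Lip_α(K, E)` such that
`‖F x₀ - F x‖ / d(x₀, x) ^ α → 0` as `x → x₀`, `x ≠ x₀`, for every `x₀` in `K`. -/
def LittleLipSpace (α : ℝ) (K E : Type*) [MetricSpace K] [NormedAddCommGroup E]
    [NormedSpace ℂ E] : Submodule ℂ C(K, E) where
  carrier := {F | F ∈ LipSpace α K E ∧
    ∀ x₀ : K, Tendsto (fun x => ‖F x₀ - F x‖ / dist x₀ x ^ α) (𝓝[≠] x₀) (𝓝 0)}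
  zero_mem' := ⟨zero_mem _, fun x₀ => by simpa using tendsto_const_nhds⟩
  add_mem' := by
    rintro F G ⟨hF, hF'⟩ ⟨hG, hG'⟩
    refine ⟨add_mem hF hG, fun x₀ => ?_⟩
    have h := (hF' x₀).add (hG' x₀)
    rw [add_zero] at h
    refine squeeze_zero (fun x => div_nonneg (norm_nonneg _) (Real.rpow_nonneg dist_nonneg α))
      (fun x => ?_) h
    rw [← add_div]
    refine div_le_div_of_nonneg_right ?_ (Real.rpow_nonneg dist_nonneg α)
    simp only [ContinuousMap.add_apply]
    rw [add_sub_add_comm]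
    exact norm_add_le _ _
  smul_mem' := by
    rintro c F ⟨hF, hF'⟩
    refine ⟨Submodule.smul_mem _ c hF, fun x₀ => ?_⟩
    have h := (hF' x₀).const_mul ‖c‖
    rw [mul_zero] at h
    refine h.congr fun x => ?_
    simp only [ContinuousMap.smul_apply]
    rw [← smul_sub, norm_smul, mul_div_assoc]

/-- The sum norm `‖F‖_∞ + L_α(F)`; `‖F‖` is the supremum norm of `C(K, E)`. -/
noncomputable def sumNorm {K E : Type*} [MetricSpace K] [CompactSpace K] [NormedAddCommGroup E]
    (α : ℝ) (F : C(K, E)) : ℝ :=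
  ‖F‖ + lipNumber α F

/-- `U` is a surjective complex-linear isometry between the spaces `A₁` and `A₂` of `E₁`- and
`E₂`-valued maps, both with the sum norm of exponent `α`. -/
def IsSurjectiveSumNormIsometry {K₁ K₂ E₁ E₂ : Type*}
    [MetricSpace K₁] [CompactSpace K₁] [MetricSpace K₂] [CompactSpace K₂]
    [NormedAddCommGroup E₁] [NormedSpace ℂ E₁] [NormedAddCommGroup E₂] [NormedSpace ℂ E₂]
    (α : ℝ) (A₁ : Submodule ℂ C(K₁, E₁)) (A₂ : Submodule ℂ C(K₂, E₂)) (U : A₁ → A₂) : Prop :=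
  IsLinearMap ℂ U ∧ Function.Surjective U ∧
    ∀ F : A₁, sumNorm α (U F : C(K₂, E₂)) = sumNorm α (F : C(K₁, E₁))

/-! Write N for the sum norm. The forward direction uses only that the function space consists of
`α`-Lipschitz maps, contains every Lipschitz map, and contains every map whose increments are
dominated by those of a member (`IsLipschitzType`). Both spaces of the theorem qualify, so one
argument serves both.

The constant 1 is a spear: for every F some unimodular c gives N(F + c) = N(F) + 1, because
constants do not affect the Lipschitz number. A surjective isometry carries this property to u =
U(1). Testing it on 1 + i Re(μu), for a suitable rotation μ, forces L(u) = 0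
(`lipNumber_eq_zero_of_spear`). Hence u is a function h(y), and testing on 1 - |h| gives |h| = 1.
Multiplying by the conjugate of h reduces to U(1) = 1.

For unital U, adding a large constant M and letting M grow turns the supremum norm into the maximum
of the real part, so max Re(zF) + |z| L(F) is preserved for every complex z. A perturbation argument
then shows that L(F) itself is preserved when F is real (`lipNumber_map_of_real`). Consequently real
maps go to real maps with the same maximum. Compactness turns preservation of maxima into point
evaluations: U(F)(x, y) = F(Φ(x, y)). Preservation of L on maps depending only on y shows that the
second coordinate of Φ does not depend on x. On truncated distance functions it shows that the first
coordinate is 1-Lipschitz in x, and the inverse of U supplies the reverse inequality.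

Conversely, the formula gives a linear isometry at once; surjectivity is the issue. The family of
isometries φ(·, y) has a continuous fiberwise inverse ψ, which settles Lip. The little Lipschitz
condition is imposed at each base point separately, with no uniformity between base points, while
ψ(a, y) may move with y. What saves the statement is that U is assumed to take values in the little
Lipschitz space: this forces φ(x₀, ·) to be locally constant (`eventually_eq_of_form`), so only
finitely many base points ψ(a, y) occur for each a. -/

set_option linter.unusedSectionVars false

/-! ### Difference quotients, Lipschitz numbers and maxima of real parts. -/

section Basics

variable {X Y : Type*} [MetricSpace X] [TopologicalSpace Y] [CompactSpace Y]

/-- The scalar difference quotient of `F` at the points `(x, y)`, `(x', y)`. -/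
noncomputable def diffQuot (α : ℝ) (F : C(X, C(Y, ℂ))) (x x' : X) (y : Y) : ℂ :=
  (F x y - F x' y) / ((dist x x' ^ α : ℝ) : ℂ)

theorem diffQuot_add (α : ℝ) (F G : C(X, C(Y, ℂ))) (x x' : X) (y : Y) :
    diffQuot α (F + G) x x' y = diffQuot α F x x' y + diffQuot α G x x' y := by
  simp only [diffQuot, ContinuousMap.add_apply]; ring

theorem diffQuot_smul (α : ℝ) (c : ℂ) (F : C(X, C(Y, ℂ))) (x x' : X) (y : Y) :
    diffQuot α (c • F) x x' y = c * diffQuot α F x x' y := by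
  simp only [diffQuot, ContinuousMap.smul_apply, smul_eq_mul]; ring

theorem diffQuot_const (α : ℝ) (g : C(Y, ℂ)) (x x' : X) (y : Y) :
    diffQuot α (ContinuousMap.const X g) x x' y = 0 := by
  simp [diffQuot]

theorem norm_diffQuot (α : ℝ) (F : C(X, C(Y, ℂ))) (x x' : X) (y : Y) :
    ‖diffQuot α F x x' y‖ = ‖F x y - F x' y‖ / dist x x' ^ α := by
  rw [diffQuot, norm_div, Complex.norm_real, Real.norm_of_nonneg (Real.rpow_nonneg dist_nonneg α)]

theorem norm_diffQuot_le {α : ℝ} {F : C(X, C(Y, ℂ))} (hF : F ∈ LipSpace α X C(Y, ℂ))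
    (x x' : X) (y : Y) : ‖diffQuot α F x x' y‖ ≤ lipNumber α F := by
  by_cases hx : x = x'
  · subst hx
    simp only [diffQuot, sub_self, zero_div, norm_zero]
    apply Real.sSup_nonneg
    rintro r ⟨a, b, -, rfl⟩
    exact div_nonneg (norm_nonneg _) (Real.rpow_nonneg dist_nonneg α)
  · rw [norm_diffQuot]
    refine le_trans ?_ (le_csSup hF ⟨x, x', hx, rfl⟩)
    exact div_le_div_of_nonneg_right (ContinuousMap.norm_coe_le_norm (F x - F x') y)
      (Real.rpow_nonneg dist_nonneg α)

theorem norm_sub_div_le_of_diffQuot {α C : ℝ} (hC : 0 ≤ C) {F : C(X, C(Y, ℂ))} {x x' : X}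
    (h : ∀ y, ‖diffQuot α F x x' y‖ ≤ C) :
    ‖F x - F x'‖ / dist x x' ^ α ≤ C := by
  by_cases hx : x = x'
  · subst hx; simpa using hC
  have hd : 0 < dist x x' ^ α := Real.rpow_pos_of_pos (dist_pos.2 hx) α
  rw [div_le_iff₀ hd, ContinuousMap.norm_le _ (mul_nonneg hC hd.le)]
  intro y
  have := h y
  rwa [norm_diffQuot, div_le_iff₀ hd] at this

theorem lipNumber_le {α C : ℝ} (hC : 0 ≤ C) {F : C(X, C(Y, ℂ))}
    (h : ∀ x x' y, ‖diffQuot α F x x' y‖ ≤ C) : lipNumber α F ≤ C := by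
  refine Real.sSup_le ?_ hC
  rintro r ⟨x, x', hx, rfl⟩
  exact norm_sub_div_le_of_diffQuot hC (h x x')

theorem mem_lipSpace_of_diffQuot {α C : ℝ} (hC : 0 ≤ C) {F : C(X, C(Y, ℂ))}
    (h : ∀ x x' y, ‖diffQuot α F x x' y‖ ≤ C) : F ∈ LipSpace α X C(Y, ℂ) := by
  refine ⟨C, ?_⟩
  rintro r ⟨x, x', hx, rfl⟩
  exact norm_sub_div_le_of_diffQuot hC (h x x')

theorem lipNumber_nonneg {K E : Type*} [MetricSpace K] [NormedAddCommGroup E] (α : ℝ)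
    (F : C(K, E)) : 0 ≤ lipNumber α F := by
  apply Real.sSup_nonneg
  rintro r ⟨a, b, -, rfl⟩
  exact div_nonneg (norm_nonneg _) (Real.rpow_nonneg dist_nonneg α)

theorem lipNumber_add_le {α : ℝ} {F G : C(X, C(Y, ℂ))} (hF : F ∈ LipSpace α X C(Y, ℂ))
    (hG : G ∈ LipSpace α X C(Y, ℂ)) :
    lipNumber α (F + G) ≤ lipNumber α F + lipNumber α G := by
  refine lipNumber_le (add_nonneg (lipNumber_nonneg _ _) (lipNumber_nonneg _ _)) fun x x' y => ?_
  rw [diffQuot_add]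
  exact (norm_add_le _ _).trans (add_le_add (norm_diffQuot_le hF _ _ _) (norm_diffQuot_le hG _ _ _))

theorem lipNumber_smul_le {α : ℝ} (c : ℂ) {F : C(X, C(Y, ℂ))} (hF : F ∈ LipSpace α X C(Y, ℂ)) :
    lipNumber α (c • F) ≤ ‖c‖ * lipNumber α F := by
  refine lipNumber_le (mul_nonneg (norm_nonneg _) (lipNumber_nonneg _ _)) fun x x' y => ?_
  rw [diffQuot_smul, norm_mul]
  exact mul_le_mul_of_nonneg_left (norm_diffQuot_le hF _ _ _) (norm_nonneg _)

theorem lipNumber_smul {α : ℝ} (c : ℂ) {F : C(X, C(Y, ℂ))} (hF : F ∈ LipSpace α X C(Y, ℂ)) :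
    lipNumber α (c • F) = ‖c‖ * lipNumber α F := by
  refine le_antisymm (lipNumber_smul_le c hF) ?_
  by_cases hc : c = 0
  · simpa [hc] using lipNumber_nonneg _ _
  have h := lipNumber_smul_le c⁻¹ (Submodule.smul_mem _ c hF)
  rw [smul_smul, inv_mul_cancel₀ hc, one_smul, norm_inv] at h
  rwa [← le_inv_mul_iff₀ (norm_pos_iff.2 hc)]

theorem lipNumber_congr {α : ℝ} {F G : C(X, C(Y, ℂ))}
    (h : ∀ x x', ‖F x - F x'‖ = ‖G x - G x'‖) : lipNumber α F = lipNumber α G := by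
  simp only [lipNumber, lipQuotients, h]

theorem lipNumber_add_const (α : ℝ) (F : C(X, C(Y, ℂ))) (g : C(Y, ℂ)) :
    lipNumber α (F + ContinuousMap.const X g) = lipNumber α F :=
  lipNumber_congr fun x x' => by simp

theorem lipNumber_const (α : ℝ) (g : C(Y, ℂ)) : lipNumber α (ContinuousMap.const X g) = 0 :=
  le_antisymm (lipNumber_le le_rfl fun x x' y => by simp [diffQuot_const]) (lipNumber_nonneg _ _)

/-- Post-composition of a `C(Y)`-valued map with a continuous function on `ℂ`. -/
noncomputable def postComp (k : C(ℂ, ℂ)) (F : C(X, C(Y, ℂ))) : C(X, C(Y, ℂ)) :=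
  ⟨fun x => k.comp (F x), (ContinuousMap.continuous_postcomp k).comp F.continuous⟩

@[simp] theorem postComp_apply (k : C(ℂ, ℂ)) (F : C(X, C(Y, ℂ))) (x : X) (y : Y) :
    postComp k F x y = k (F x y) := rfl

theorem norm_postComp_sub_le (k : C(ℂ, ℂ)) (hk : ∀ z w, ‖k z - k w‖ ≤ ‖z - w‖)
    (F : C(X, C(Y, ℂ))) (x x' : X) :
    ‖postComp k F x - postComp k F x'‖ ≤ ‖F x - F x'‖ := by
  rw [ContinuousMap.norm_le _ (norm_nonneg _)]
  exact fun y => (hk _ _).trans (ContinuousMap.norm_coe_le_norm (F x - F x') y)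

/-- The real part, as a continuous map from `ℂ` to `ℂ`. -/
noncomputable def reMap : C(ℂ, ℂ) := ⟨fun z => (z.re : ℂ), by fun_prop⟩

@[simp] theorem reMap_apply (z : ℂ) : reMap z = (z.re : ℂ) := rfl

theorem norm_reMap_sub_le (z w : ℂ) : ‖reMap z - reMap w‖ ≤ ‖z - w‖ := by
  rw [reMap_apply, reMap_apply, ← Complex.ofReal_sub, Complex.norm_real, ← Complex.sub_re]
  exact Complex.abs_re_le_norm _

theorem diffQuot_postComp_reMap (α : ℝ) (F : C(X, C(Y, ℂ))) (x x' : X) (y : Y) :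
    diffQuot α (postComp reMap F) x x' y = ((diffQuot α F x x' y).re : ℂ) := by
  simp only [diffQuot, postComp_apply, reMap_apply, Complex.div_ofReal_re, Complex.sub_re]
  push_cast; ring

/-- The properties of a space of `α`-Lipschitz maps that determine its isometries: it contains all
Lipschitz maps, and all maps whose increments are dominated by those of one of its members. -/
structure IsLipschitzType (α : ℝ) (A : Submodule ℂ C(X, C(Y, ℂ))) : Prop where
  le_lipSpace : A ≤ LipSpace α X C(Y, ℂ)
  mem_of_dominated : ∀ F ∈ A, ∀ G : C(X, C(Y, ℂ)),
    (∀ x x', ‖G x - G x'‖ ≤ ‖F x - F x'‖) → G ∈ A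
  mem_of_lipschitz : ∀ (G : C(X, C(Y, ℂ))) (C : ℝ),
    (∀ x x', ‖G x - G x'‖ ≤ C * dist x x') → G ∈ A

namespace IsLipschitzType

variable {α : ℝ} {A : Submodule ℂ C(X, C(Y, ℂ))}

theorem const_mem (hA : IsLipschitzType α A) (g : C(Y, ℂ)) : ContinuousMap.const X g ∈ A :=
  hA.mem_of_lipschitz _ 0 fun x x' => by simp

theorem one_mem (hA : IsLipschitzType α A) : (1 : C(X, C(Y, ℂ))) ∈ A := hA.const_mem 1

theorem postComp_mem (hA : IsLipschitzType α A) {F : C(X, C(Y, ℂ))} (hF : F ∈ A) (k : C(ℂ, ℂ))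
    (hk : ∀ z w, ‖k z - k w‖ ≤ ‖z - w‖) : postComp k F ∈ A :=
  hA.mem_of_dominated F hF _ (norm_postComp_sub_le k hk F)

end IsLipschitzType

theorem continuous_apply_pair (F : C(X, C(Y, ℂ))) : Continuous fun p : X × Y => F p.1 p.2 := by
  fun_prop

variable [CompactSpace X]

theorem norm_apply_apply_le (F : C(X, C(Y, ℂ))) (x : X) (y : Y) : ‖F x y‖ ≤ ‖F‖ :=
  (ContinuousMap.norm_coe_le_norm (F x) y).trans (ContinuousMap.norm_coe_le_norm F x)

theorem norm_le_of_apply_apply {F : C(X, C(Y, ℂ))} {C : ℝ} (hC : 0 ≤ C)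
    (h : ∀ x y, ‖F x y‖ ≤ C) : ‖F‖ ≤ C :=
  (ContinuousMap.norm_le _ hC).2 fun x => (ContinuousMap.norm_le _ hC).2 (h x)

theorem exists_norm_apply_apply_eq [Nonempty X] [Nonempty Y] (F : C(X, C(Y, ℂ))) :
    ∃ x y, ‖F x y‖ = ‖F‖ := by
  obtain ⟨p, -, hp⟩ := isCompact_univ.exists_isMaxOn (univ_nonempty (α := X × Y))
    (continuous_apply_pair F).norm.continuousOn
  exact ⟨p.1, p.2, le_antisymm (norm_apply_apply_le F _ _)
    (norm_le_of_apply_apply (norm_nonneg _) fun x y => hp (mem_univ (x, y)))⟩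

/-- The maximum of the real part of `F x y`. -/
noncomputable def reMax (F : C(X, C(Y, ℂ))) : ℝ := sSup (range fun p : X × Y => (F p.1 p.2).re)

theorem re_le_reMax (F : C(X, C(Y, ℂ))) (x : X) (y : Y) : (F x y).re ≤ reMax F :=
  le_csSup (isCompact_range (Complex.continuous_re.comp (continuous_apply_pair F))).bddAbove
    ⟨(x, y), rfl⟩

theorem exists_re_eq_reMax [Nonempty X] [Nonempty Y] (F : C(X, C(Y, ℂ))) :
    ∃ x y, (F x y).re = reMax F := by
  obtain ⟨p, hp⟩ := (isCompact_range (Complex.continuous_re.comp (continuous_apply_pair F))).sSup_mem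
    (range_nonempty _)
  exact ⟨p.1, p.2, hp⟩

theorem reMax_eq [Nonempty X] [Nonempty Y] {F : C(X, C(Y, ℂ))} {m : ℝ}
    (h : ∀ x y, (F x y).re ≤ m) (x : X) (y : Y) (hxy : (F x y).re = m) : reMax F = m := by
  obtain ⟨a, b, hab⟩ := exists_re_eq_reMax F
  exact le_antisymm (hab ▸ h a b) (hxy ▸ re_le_reMax F x y)

end Basics

/-! ### The image of the constant 1 is a unimodular function of y. -/

section Spear

variable {X Y : Type*} [MetricSpace X] [CompactSpace X] [TopologicalSpace Y] [CompactSpace Y]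

/-- The supremum defining L(u) need not be attained, so a rotation cannot be read off from one
quotient. Instead μ ↦ L(Re(μu)) is Lipschitz and has a maximum on the unit circle; every quotient d
becomes |d| after some rotation, so this maximum dominates all |d|. -/
theorem exists_rotation_lipNumber_re {α : ℝ} {A : Submodule ℂ C(X, C(Y, ℂ))}
    (hA : IsLipschitzType α A) {u : C(X, C(Y, ℂ))} (hu : u ∈ A) :
    ∃ μ : ℂ, ‖μ‖ = 1 ∧ lipNumber α (postComp reMap (μ • u)) = lipNumber α u := by
  have hmem : ∀ μ : ℂ, postComp reMap (μ • u) ∈ LipSpace α X C(Y, ℂ) := fun μ =>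
    hA.le_lipSpace (hA.postComp_mem (A.smul_mem μ hu) _ norm_reMap_sub_le)
  have hle : ∀ μ ν : ℂ, lipNumber α (postComp reMap (μ • u)) ≤
      lipNumber α (postComp reMap (ν • u)) + ‖μ - ν‖ * lipNumber α u := by
    intro μ ν
    refine lipNumber_le (add_nonneg (lipNumber_nonneg _ _)
      (mul_nonneg (norm_nonneg _) (lipNumber_nonneg _ _))) fun x x' y => ?_
    have h1 := norm_diffQuot_le (hmem ν) x x' y
    have h2 := norm_diffQuot_le (hA.le_lipSpace hu) x x' y
    rw [diffQuot_postComp_reMap, diffQuot_smul, Complex.norm_real, Real.norm_eq_abs] at h1 ⊢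
    have h3 : μ * diffQuot α u x x' y = ν * diffQuot α u x x' y + (μ - ν) * diffQuot α u x x' y := by
      ring
    rw [h3, Complex.add_re]
    refine (abs_add_le _ _).trans (add_le_add h1 ?_)
    refine (Complex.abs_re_le_norm _).trans ?_
    rw [norm_mul]
    exact mul_le_mul_of_nonneg_left h2 (norm_nonneg _)
  have hcont : Continuous fun μ : ℂ => lipNumber α (postComp reMap (μ • u)) := by
    refine LipschitzWith.continuous (K := (lipNumber α u).toNNReal)
      (LipschitzWith.of_dist_le_mul fun μ ν => ?_)
    rw [Real.coe_toNNReal _ (lipNumber_nonneg _ _), Real.dist_eq, dist_eq_norm, abs_le]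
    have h1 := hle μ ν
    have h2 := hle ν μ
    rw [norm_sub_rev] at h2
    constructor <;> linarith [mul_comm (lipNumber α u) ‖μ - ν‖]
  obtain ⟨μ, hμ, hmax⟩ := (isCompact_sphere (0 : ℂ) 1).exists_isMaxOn
    ⟨1, by simp⟩ hcont.continuousOn
  have hμ1 : ‖μ‖ = 1 := by simpa using hμ
  refine ⟨μ, hμ1, le_antisymm ?_ ?_⟩
  · have h := hle μ 0
    have h0 : postComp reMap ((0 : ℂ) • u) = ContinuousMap.const X 0 := by
      ext x y; simp
    rwa [h0, lipNumber_const, sub_zero, hμ1, one_mul, zero_add] at h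
  · refine lipNumber_le (lipNumber_nonneg _ _) fun x x' y => ?_
    set d := diffQuot α u x x' y with hd
    by_cases hd0 : d = 0
    · rw [hd0, norm_zero]; exact lipNumber_nonneg _ _
    have hdn : (‖d‖ : ℂ) ≠ 0 := by exact_mod_cast norm_ne_zero_iff.2 hd0
    have hν : ‖(‖d‖ : ℂ) / d‖ = 1 := by
      rw [norm_div, Complex.norm_real, norm_norm, div_self (norm_ne_zero_iff.2 hd0)]
    have h := norm_diffQuot_le (hmem ((‖d‖ : ℂ) / d)) x x' y
    rw [diffQuot_postComp_reMap, diffQuot_smul, ← hd, div_mul_cancel₀ _ hd0, Complex.ofReal_re,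
      Complex.norm_real, norm_norm] at h
    exact h.trans (hmax (by simpa using hν))

/-- If `|ν| = 1` and `ν ≠ i`, then the map `d ↦ i Re d + ν d` has norm less than `2`. -/
theorem norm_I_mul_re_add_mul_sq_le {ν d : ℂ} (hν : ‖ν‖ = 1) :
    ‖Complex.I * (d.re : ℂ) + ν * d‖ ^ 2 ≤ (4 - (1 - ν.im) / 2) * ‖d‖ ^ 2 := by
  have h1 : ν.re ^ 2 + ν.im ^ 2 = 1 := by
    have := Complex.sq_norm ν
    rw [hν, Complex.normSq_apply] at this; linarith
  rw [Complex.sq_norm, Complex.sq_norm, Complex.normSq_apply, Complex.normSq_apply]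
  simp only [Complex.add_re, Complex.add_im, Complex.mul_re, Complex.mul_im, Complex.I_re,
    Complex.I_im, Complex.ofReal_re, Complex.ofReal_im]
  set a := d.re
  set b := d.im
  set p := ν.re
  set s := 1 - ν.im with hs
  have hm : ν.im = 1 - s := by rw [hs]; ring
  rw [hm] at h1 ⊢
  have hs0 : 0 ≤ s := by nlinarith [sq_nonneg p]
  have hs2 : s ≤ 2 := by nlinarith [sq_nonneg p]
  have hp : p ^ 2 = s * (2 - s) := by linarith
  -- This form is the right side minus the left. With p² = s(2 - s) it is nonnegative by completing
  -- the square after multiplication by 3s/2, which requires s ≠ 0.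
  have key : 0 ≤ (3 * s / 2) * a ^ 2 - 2 * p * a * b + (3 - s / 2) * b ^ 2 := by
    rcases hs0.eq_or_lt with h0 | h0
    · rw [← h0] at hp ⊢
      have : p = 0 := by nlinarith
      rw [this]; nlinarith [sq_nonneg b]
    · have : 0 ≤ (3 * s / 2) * ((3 * s / 2) * a ^ 2 - 2 * p * a * b + (3 - s / 2) * b ^ 2) := by
        have : (3 * s / 2) * ((3 * s / 2) * a ^ 2 - 2 * p * a * b + (3 - s / 2) * b ^ 2) =
          (3 * s / 2 * a - p * b) ^ 2 + s * (5 / 2 + s / 4) * b ^ 2 := by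
          linear_combination (-b ^ 2) * hp
        rw [this]; positivity
      exact nonneg_of_mul_nonneg_right this (by positivity)
  have hpb : p ^ 2 * (a ^ 2 + b ^ 2) = s * (2 - s) * (a ^ 2 + b ^ 2) := by rw [hp]
  linarith

/-- With w = r + im, squaring the equality twice leaves r²(1 + m)² = 0, and |w| < 1 excludes m = -1.
-/
theorem re_eq_zero_of_norm_add_eq {w : ℂ} (hw : ‖w‖ < 1)
    (h : ‖1 + Complex.I * (w.re : ℂ) + Complex.I * w‖ =
      ‖1 + Complex.I * (w.re : ℂ)‖ + ‖w‖) : w.re = 0 := by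
  have g1 := Complex.sq_norm (1 + Complex.I * (w.re : ℂ))
  have g2 := Complex.sq_norm w
  have g3 := Complex.sq_norm (1 + Complex.I * (w.re : ℂ) + Complex.I * w)
  rw [h] at g3
  rw [Complex.normSq_apply] at g1 g2 g3
  simp only [Complex.add_re, Complex.add_im, Complex.mul_re, Complex.mul_im, Complex.I_re,
    Complex.I_im, Complex.ofReal_re, Complex.ofReal_im, Complex.one_re, Complex.one_im] at g1 g2 g3
  have hm1 : -1 < w.im := by linarith [(abs_le.1 (Complex.abs_im_le_norm w)).1]
  generalize ‖1 + Complex.I * (w.re : ℂ)‖ = P at *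
  generalize ‖w‖ = Q at *
  generalize w.re = r at *
  generalize w.im = m at *
  have g4 : P * Q = r ^ 2 - m := by linarith
  have g5 : (1 + r ^ 2) * (r ^ 2 + m ^ 2) = (r ^ 2 - m) ^ 2 := by
    rw [← g4, mul_pow, g1, g2]; ring
  have g6 : r ^ 2 * (1 + m) ^ 2 = 0 := by linarith
  rcases mul_eq_zero.1 g6 with h | h
  · exact pow_eq_zero_iff two_ne_zero |>.1 h
  · have := pow_eq_zero_iff two_ne_zero |>.1 h
    linarith

variable [Nonempty X] [Nonempty Y]

/-- Take c in the direction of F at a point where |F| is maximal; the shift leaves the Lipschitz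
number unchanged. -/
theorem exists_sumNorm_add_one (α : ℝ) (F : C(X, C(Y, ℂ))) :
    ∃ c : ℂ, ‖c‖ = 1 ∧ sumNorm α (F + c • 1) = sumNorm α F + 1 := by
  obtain ⟨x, y, hxy⟩ := exists_norm_apply_apply_eq F
  obtain ⟨c, hc, hcn⟩ : ∃ c : ℂ, ‖c‖ = 1 ∧ ‖F x y + c‖ = ‖F x y‖ + 1 := by
    by_cases h0 : F x y = 0
    · exact ⟨1, by simp, by simp [h0]⟩
    · have hn : ‖F x y‖ ≠ 0 := norm_ne_zero_iff.2 h0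
      refine ⟨F x y / (‖F x y‖ : ℝ), by simp [hn], ?_⟩
      have : F x y + F x y / (‖F x y‖ : ℝ) = ((1 + ‖F x y‖⁻¹ : ℝ) : ℂ) * F x y := by
        push_cast; ring
      rw [this, norm_mul, Complex.norm_real, Real.norm_of_nonneg (by positivity)]
      field_simp
  refine ⟨c, hc, ?_⟩
  have h1 : F + c • (1 : C(X, C(Y, ℂ))) = F + ContinuousMap.const X (c • 1) := by ext; simp
  have h2 : ‖F + c • (1 : C(X, C(Y, ℂ)))‖ = ‖F‖ + 1 := by
    refine le_antisymm ?_ ?_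
    · refine norm_le_of_apply_apply (by positivity) fun a b => ?_
      have : (F + c • (1 : C(X, C(Y, ℂ)))) a b = F a b + c := by simp
      rw [this, ← hc]
      exact (norm_add_le _ _).trans (add_le_add_left (norm_apply_apply_le F a b) _)
    · have h := norm_apply_apply_le (F + c • (1 : C(X, C(Y, ℂ)))) x y
      have : (F + c • (1 : C(X, C(Y, ℂ)))) x y = F x y + c := by simp
      rwa [this, hcn, hxy] at h
  rw [sumNorm, h2, h1, lipNumber_add_const, sumNorm]; ring

/-- If L(u) = ℓ > 0, then ‖u‖ < 1. Additivity of the Lipschitz part fixes the rotation in the spear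
condition, and additivity of the supremum part then makes Re w vanish, against L(Re w) = ℓ. -/
theorem lipNumber_eq_zero_of_spear {α : ℝ} {A : Submodule ℂ C(X, C(Y, ℂ))}
    (hA : IsLipschitzType α A) {u : C(X, C(Y, ℂ))} (hu : u ∈ A) (hN : sumNorm α u = 1)
    (hspear : ∀ G ∈ A, ∃ c : ℂ, ‖c‖ = 1 ∧ sumNorm α (G + c • u) = sumNorm α G + 1) :
    lipNumber α u = 0 := by
  by_contra hne
  have hl : 0 < lipNumber α u := (lipNumber_nonneg _ _).lt_of_ne' hne
  obtain ⟨μ, hμ, hμL⟩ := exists_rotation_lipNumber_re hA hu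
  set w := μ • u with hw
  have hwA : w ∈ A := A.smul_mem _ hu
  set R := postComp reMap w with hR
  have hRA : R ∈ A := hA.postComp_mem hwA _ norm_reMap_sub_le
  have hwn : ‖w‖ = ‖u‖ := by rw [hw, norm_smul, hμ, one_mul]
  have hwL : lipNumber α w = lipNumber α u := by
    rw [hw, lipNumber_smul _ (hA.le_lipSpace hu), hμ, one_mul]
  set ℓ := lipNumber α u with hℓ
  have hun : ‖u‖ + ℓ = 1 := hN
  have hiR : Complex.I • R ∈ A := A.smul_mem _ hRA
  have hiRL : lipNumber α (Complex.I • R) = ℓ := by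
    rw [lipNumber_smul _ (hA.le_lipSpace hRA), Complex.norm_I, one_mul, hμL]
  -- The factor i makes |G|² = 1 + (Re w)², so ‖G‖ = 1 would force Re w = 0 everywhere.
  set G := Complex.I • R + ContinuousMap.const X 1 with hG
  have hGL : lipNumber α G = ℓ := by rw [hG, lipNumber_add_const, hiRL]
  have hGA : G ∈ A := A.add_mem hiR (hA.const_mem 1)
  obtain ⟨c, hc, hcN⟩ := hspear G hGA
  have hμ0 : μ ≠ 0 := fun h => by simp [h] at hμ
  obtain ⟨ν, hν, hνu⟩ : ∃ ν : ℂ, ‖ν‖ = 1 ∧ c • u = ν • w := by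
    refine ⟨c / μ, by rw [norm_div, hc, hμ, div_one], ?_⟩
    rw [hw, smul_smul, div_mul_cancel₀ _ hμ0]
  rw [hνu] at hcN
  have hνwA : ν • w ∈ A := A.smul_mem _ hwA
  have h1 : ‖G + ν • w‖ ≤ ‖G‖ + ‖u‖ := by
    refine (norm_add_le _ _).trans_eq ?_
    rw [norm_smul, hν, one_mul, hwn]
  have h2 : lipNumber α (G + ν • w) ≤ 2 * ℓ := by
    refine (lipNumber_add_le (hA.le_lipSpace hGA) (hA.le_lipSpace hνwA)).trans_eq ?_
    rw [lipNumber_smul _ (hA.le_lipSpace hwA), hν, hGL, hwL]; ring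
  simp only [sumNorm, hGL] at hcN
  -- The two triangle inequalities add up to an equality, so each of them is an equality.
  have h3 : ‖G + ν • w‖ = ‖G‖ + ‖u‖ := by linarith
  have h4 : lipNumber α (G + ν • w) = 2 * ℓ := by linarith
  -- The quotients of G + νw are i Re d + νd. For ν ≠ i these are bounded by a constant below 2
  -- times ℓ, so 2ℓ is out of reach.
  have hνI : ν = Complex.I := by
    have hre : ν.re ^ 2 + ν.im ^ 2 = 1 := by
      have := Complex.sq_norm ν
      rw [hν, Complex.normSq_apply] at this; linarith
    have him : ν.im ≤ 1 := by nlinarith [sq_nonneg ν.re]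
    have hk : 0 ≤ 4 - (1 - ν.im) / 2 := by nlinarith [sq_nonneg ν.re]
    have hb : lipNumber α (G + ν • w) ≤ Real.sqrt (4 - (1 - ν.im) / 2) * ℓ := by
      refine lipNumber_le (mul_nonneg (Real.sqrt_nonneg _) hl.le) fun x x' y => ?_
      have e : diffQuot α (G + ν • w) x x' y = Complex.I * ((diffQuot α w x x' y).re : ℂ) +
          ν * diffQuot α w x x' y := by
        rw [hG, diffQuot_add, diffQuot_add, diffQuot_const, add_zero, diffQuot_smul,
          diffQuot_smul, hR, diffQuot_postComp_reMap]
      rw [e]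
      have hd := norm_diffQuot_le (hA.le_lipSpace hwA) x x' y
      rw [hwL] at hd
      have h5 := norm_I_mul_re_add_mul_sq_le (d := diffQuot α w x x' y) hν
      refine abs_le_of_sq_le_sq' ?_ (mul_nonneg (Real.sqrt_nonneg _) hl.le) |>.2
      rw [mul_pow, Real.sq_sqrt hk]
      exact h5.trans (mul_le_mul_of_nonneg_left (pow_le_pow_left₀ (norm_nonneg _) hd 2) hk)
    rw [h4] at hb
    have h6 : 2 ≤ Real.sqrt (4 - (1 - ν.im) / 2) := le_of_mul_le_mul_right hb hl
    have h7 := (Real.le_sqrt (by norm_num) hk).1 h6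
    have h8 : ν.im = 1 := by linarith
    have h9 : ν.re = 0 := by rw [h8] at hre; nlinarith
    exact Complex.ext (by simpa using h9) (by simpa using h8)
  obtain ⟨x, y, hxy⟩ := exists_norm_apply_apply_eq (G + ν • w)
  have hGv : ∀ a b, G a b = 1 + Complex.I * ((w a b).re : ℂ) := by
    intro a b; simp [hG, hR]; ring
  have hwv : ‖w x y‖ ≤ ‖u‖ := hwn ▸ norm_apply_apply_le w x y
  have hGx : ‖G x y‖ ≤ ‖G‖ := norm_apply_apply_le G x y
  have e1 : (G + ν • w) x y = G x y + Complex.I * w x y := by simp [hνI]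
  have h5 : ‖G x y + Complex.I * w x y‖ ≤ ‖G x y‖ + ‖w x y‖ := by
    simpa using norm_add_le (G x y) (Complex.I * w x y)
  rw [e1, h3] at hxy
  have h6 : ‖G x y‖ = ‖G‖ := by linarith
  have h7 : ‖w x y‖ = ‖u‖ := by linarith
  have h8 : ‖G x y + Complex.I * w x y‖ = ‖G x y‖ + ‖w x y‖ := by linarith
  have hr : (w x y).re = 0 := by
    rw [hGv] at h8
    exact re_eq_zero_of_norm_add_eq (by linarith) h8
  have hG1 : ‖G‖ = 1 := by rw [← h6, hGv, hr]; simp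
  have hR0 : R = ContinuousMap.const X 0 := by
    ext a b
    have h := norm_apply_apply_le G a b
    rw [hG1, hGv] at h
    have h' := Complex.sq_norm (1 + Complex.I * ((w a b).re : ℂ))
    rw [Complex.normSq_apply] at h'
    simp only [Complex.add_re, Complex.add_im, Complex.mul_re, Complex.mul_im, Complex.I_re,
      Complex.I_im, Complex.ofReal_re, Complex.ofReal_im, Complex.one_re, Complex.one_im] at h'
    have h0 : (w a b).re = 0 := by nlinarith [norm_nonneg (1 + Complex.I * ((w a b).re : ℂ))]
    simp [hR, h0]
  rw [hR0, lipNumber_const] at hμL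
  exact hne hμL.symm

theorem exists_unimodular_of_spear {α : ℝ} {A : Submodule ℂ C(X, C(Y, ℂ))}
    (hA : IsLipschitzType α A) {u : C(X, C(Y, ℂ))} (hu : u ∈ A) (hN : sumNorm α u = 1)
    (hspear : ∀ G ∈ A, ∃ c : ℂ, ‖c‖ = 1 ∧ sumNorm α (G + c • u) = sumNorm α G + 1) :
    ∃ h : C(Y, ℂ), (∀ y, ‖h y‖ = 1) ∧ u = ContinuousMap.const X h := by
  have hL := lipNumber_eq_zero_of_spear hA hu hN hspear
  obtain ⟨x₀⟩ := ‹Nonempty X›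
  have hconst : u = ContinuousMap.const X (u x₀) := by
    ext x y
    have h := norm_diffQuot_le (hA.le_lipSpace hu) x x₀ y
    rw [hL, norm_diffQuot] at h
    by_cases hx : x = x₀
    · simp [hx]
    have hd : 0 < dist x x₀ ^ α := Real.rpow_pos_of_pos (dist_pos.2 hx) α
    rw [div_le_iff₀ hd, zero_mul, norm_le_zero_iff, sub_eq_zero] at h
    simpa using h
  set h := u x₀ with hh
  have hun : ‖u‖ = 1 := by rw [sumNorm, hL, add_zero] at hN; exact hN
  refine ⟨h, ?_, hconst⟩
  have hle : ∀ y, ‖h y‖ ≤ 1 := fun y => hun ▸ norm_apply_apply_le u x₀ y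
  -- For this g every unimodular c gives |g + ch| ≤ 1, so the spear equality leaves ‖g‖ = 0.
  let g : C(Y, ℂ) := ⟨fun y => ((1 - ‖h y‖ : ℝ) : ℂ), by fun_prop⟩
  obtain ⟨c, hc, hcN⟩ := hspear _ (hA.const_mem g)
  have : Nonempty X := ⟨x₀⟩
  have e : ContinuousMap.const X g + c • u = ContinuousMap.const X (g + c • h) := by
    rw [hconst]; ext; simp
  rw [e, sumNorm, sumNorm, lipNumber_const, lipNumber_const] at hcN
  obtain ⟨x, y, hxy⟩ := exists_norm_apply_apply_eq (ContinuousMap.const X (g + c • h))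
  have h1 : ‖(ContinuousMap.const X (g + c • h)) x y‖ ≤ 1 := by
    have : (ContinuousMap.const X (g + c • h)) x y = g y + c * h y := by simp
    rw [this]
    refine (norm_add_le _ _).trans ?_
    have hg : ‖g y‖ = 1 - ‖h y‖ := by
      change ‖((1 - ‖h y‖ : ℝ) : ℂ)‖ = _
      rw [Complex.norm_real, Real.norm_of_nonneg (by linarith [hle y])]
    rw [hg, norm_mul, hc]; linarith
  have h2 : ‖ContinuousMap.const X g‖ ≤ 0 := by linarith
  intro y
  have h3 := (norm_apply_apply_le (ContinuousMap.const X g) x₀ y).trans h2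
  have h4 : ((1 - ‖h y‖ : ℝ) : ℂ) = 0 := norm_le_zero_iff.1 h3
  have h5 : 1 - ‖h y‖ = 0 := by exact_mod_cast h4
  linarith

end Spear

/-! ### Unital isometries preserve real maps, their Lipschitz numbers and their maxima. -/

section UnitalIsometry

variable {X₁ X₂ Y₁ Y₂ : Type*} [MetricSpace X₁] [CompactSpace X₁] [MetricSpace X₂] [CompactSpace X₂]
  [TopologicalSpace Y₁] [CompactSpace Y₁] [TopologicalSpace Y₂] [CompactSpace Y₂]

theorem norm_add_const_le_reMax_add (F : C(X₁, C(Y₁, ℂ))) {ε : ℝ} (hε : 0 < ε) :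
    ∃ M : ℝ, 0 ≤ M ∧ (Nonempty X₁ → Nonempty Y₁ →
      ‖F + ContinuousMap.const X₁ (ContinuousMap.const Y₁ (M : ℂ))‖ ≤ reMax F + M + ε) := by
  have hB := norm_nonneg F
  -- This M makes 2ε(max Re F + M) ≥ ‖F‖², so the imaginary part is absorbed in (max Re F + M + ε)².
  refine ⟨‖F‖ + ‖F‖ ^ 2 / (2 * ε), by positivity, fun hX hY => ?_⟩
  set M := ‖F‖ + ‖F‖ ^ 2 / (2 * ε) with hM
  have hq : 2 * ε * (‖F‖ ^ 2 / (2 * ε)) = ‖F‖ ^ 2 := by field_simp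
  have hq0 : 0 ≤ ‖F‖ ^ 2 / (2 * ε) := by positivity
  have hR : -‖F‖ ≤ reMax F := by
    obtain ⟨x, y, h⟩ := exists_re_eq_reMax F
    rw [← h]
    exact (abs_le.1 ((Complex.abs_re_le_norm _).trans (norm_apply_apply_le F x y))).1
  have hRM : ‖F‖ ^ 2 / (2 * ε) ≤ reMax F + M := by linarith
  refine norm_le_of_apply_apply (by linarith) fun x y => ?_
  have h1 := re_le_reMax F x y
  have h2 := abs_le.1 ((Complex.abs_re_le_norm _).trans (norm_apply_apply_le F x y))
  have h3 : (F x y).im ^ 2 ≤ ‖F‖ ^ 2 :=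
    sq_le_sq' (abs_le.1 ((Complex.abs_im_le_norm _).trans (norm_apply_apply_le F x y))).1
      (abs_le.1 ((Complex.abs_im_le_norm _).trans (norm_apply_apply_le F x y))).2
  have e : (F + ContinuousMap.const X₁ (ContinuousMap.const Y₁ (M : ℂ))) x y = F x y + M := rfl
  rw [e]
  refine abs_le_of_sq_le_sq' ?_ (by linarith) |>.2
  rw [Complex.sq_norm, Complex.normSq_apply]
  simp only [Complex.add_re, Complex.add_im, Complex.ofReal_re, Complex.ofReal_im, add_zero]
  have h4 : ((F x y).re + M) ^ 2 ≤ (reMax F + M) ^ 2 :=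
    pow_le_pow_left₀ (by linarith) (by linarith) 2
  have h5 : 2 * ε * (‖F‖ ^ 2 / (2 * ε)) ≤ 2 * ε * (reMax F + M) :=
    mul_le_mul_of_nonneg_left hRM (by positivity)
  nlinarith

theorem reMax_add_le_norm_add_const [Nonempty X₁] [Nonempty Y₁] (F : C(X₁, C(Y₁, ℂ))) (M : ℝ) :
    reMax F + M ≤ ‖F + ContinuousMap.const X₁ (ContinuousMap.const Y₁ (M : ℂ))‖ := by
  obtain ⟨x, y, h⟩ := exists_re_eq_reMax F
  have e : (F + ContinuousMap.const X₁ (ContinuousMap.const Y₁ (M : ℂ))) x y = F x y + M := rfl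
  have h1 := norm_apply_apply_le (F + ContinuousMap.const X₁ (ContinuousMap.const Y₁ (M : ℂ))) x y
  have h2 := (le_abs_self _).trans (Complex.abs_re_le_norm (F x y + M))
  rw [e] at h1
  simp only [Complex.add_re, Complex.ofReal_re] at h2
  linarith

/-- A linear bijection that is isometric for the sum norms and fixes the constants of `ℂ`. -/
structure IsUnitalIsometry (α : ℝ) {A₁ : Submodule ℂ C(X₁, C(Y₁, ℂ))}
    {A₂ : Submodule ℂ C(X₂, C(Y₂, ℂ))} (U : A₁ ≃ₗ[ℂ] A₂) : Prop where
  type_left : IsLipschitzType α A₁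
  type_right : IsLipschitzType α A₂
  sumNorm_map : ∀ F : A₁, sumNorm α (U F : C(X₂, C(Y₂, ℂ))) = sumNorm α (F : C(X₁, C(Y₁, ℂ)))
  map_one : U ⟨1, type_left.one_mem⟩ = ⟨1, type_right.one_mem⟩

namespace IsUnitalIsometry

variable {α : ℝ} {A₁ : Submodule ℂ C(X₁, C(Y₁, ℂ))} {A₂ : Submodule ℂ C(X₂, C(Y₂, ℂ))}
  {U : A₁ ≃ₗ[ℂ] A₂}

theorem symm (hU : IsUnitalIsometry α U) : IsUnitalIsometry α U.symm where
  type_left := hU.type_right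
  type_right := hU.type_left
  sumNorm_map F := by rw [← hU.sumNorm_map, LinearEquiv.apply_symm_apply]
  map_one := by rw [LinearEquiv.symm_apply_eq, hU.map_one]

variable [Nonempty X₁] [Nonempty X₂] [Nonempty Y₁] [Nonempty Y₂]

theorem reMax_add_lipNumber_le (hU : IsUnitalIsometry α U) (F : A₁) :
    reMax (U F : C(X₂, C(Y₂, ℂ))) + lipNumber α (U F : C(X₂, C(Y₂, ℂ))) ≤
      reMax (F : C(X₁, C(Y₁, ℂ))) + lipNumber α (F : C(X₁, C(Y₁, ℂ))) := by
  refine le_of_forall_pos_le_add fun ε hε => ?_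
  obtain ⟨M, -, hM⟩ := norm_add_const_le_reMax_add (F : C(X₁, C(Y₁, ℂ))) hε
  have hM := hM inferInstance inferInstance
  have h1 := reMax_add_le_norm_add_const (U F : C(X₂, C(Y₂, ℂ))) M
  have h2 := hU.sumNorm_map (F + (M : ℂ) • ⟨1, hU.type_left.one_mem⟩)
  rw [map_add, map_smul, hU.map_one] at h2
  have e1 : ((F + (M : ℂ) • ⟨1, hU.type_left.one_mem⟩ : A₁) : C(X₁, C(Y₁, ℂ))) =
      F + ContinuousMap.const X₁ (ContinuousMap.const Y₁ (M : ℂ)) := by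
    ext; simp
  have e2 : ((U F + (M : ℂ) • ⟨1, hU.type_right.one_mem⟩ : A₂) : C(X₂, C(Y₂, ℂ))) =
      U F + ContinuousMap.const X₂ (ContinuousMap.const Y₂ (M : ℂ)) := by
    ext; simp
  rw [e1, e2, sumNorm, sumNorm, lipNumber_add_const, lipNumber_add_const] at h2
  linarith

/-- The inequality for U and for its inverse, applied to multiples by z. Varying z gives enough
equations to separate the two summands for real maps. -/
theorem reMax_smul_add_lipNumber (hU : IsUnitalIsometry α U) (z : ℂ) {P : A₁} {Q : A₂}
    (hPQ : U P = Q) :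
    reMax (z • (Q : C(X₂, C(Y₂, ℂ)))) + ‖z‖ * lipNumber α (Q : C(X₂, C(Y₂, ℂ))) =
      reMax (z • (P : C(X₁, C(Y₁, ℂ)))) + ‖z‖ * lipNumber α (P : C(X₁, C(Y₁, ℂ))) := by
  have h1 := hU.reMax_add_lipNumber_le (z • P)
  have h2 := hU.symm.reMax_add_lipNumber_le (z • Q)
  rw [map_smul, hPQ] at h1
  rw [map_smul, ← hPQ, LinearEquiv.symm_apply_apply, hPQ] at h2
  simp only [Submodule.coe_smul] at h1 h2
  rw [lipNumber_smul _ (hU.type_left.le_lipSpace P.2),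
    lipNumber_smul _ (hU.type_right.le_lipSpace Q.2)] at h1 h2
  exact le_antisymm h1 h2

-- Let g = U(f) with f real and c = L(f) - L(g). The invariant at z = 1, i, -i gives max Re g = max
-- f + c and max(±Im g) = c, so c ≥ 0. If c > 0, one perturbs g by a small real v supported where Im
-- g is small: v raises max Re g, while neither v nor iv raises the relevant extremum of Im g. The
-- invariant for g + v and g + iv then gives inconsistent inequalities for w, the preimage of v.
set_option maxHeartbeats 1000000 in
theorem lipNumber_map_of_real (hU : IsUnitalIsometry α U) (F : A₁)
    (hF : ∀ x y, ((F : C(X₁, C(Y₁, ℂ))) x y).im = 0) :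
    lipNumber α (U F : C(X₂, C(Y₂, ℂ))) = lipNumber α (F : C(X₁, C(Y₁, ℂ))) := by
  obtain ⟨G, hG⟩ : ∃ G, U F = G := ⟨_, rfl⟩
  rw [hG]
  obtain ⟨f, hf⟩ : ∃ f : C(X₁, C(Y₁, ℂ)), f = F := ⟨_, rfl⟩
  obtain ⟨g, hg⟩ : ∃ g : C(X₂, C(Y₂, ℂ)), g = G := ⟨_, rfl⟩
  have hFG := fun z : ℂ => hU.reMax_smul_add_lipNumber z hG
  rw [← hf] at hF
  rw [← hf, ← hg] at hFG ⊢
  obtain ⟨x₀⟩ := ‹Nonempty X₁›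
  obtain ⟨y₀⟩ := ‹Nonempty Y₁›
  have : Nonempty X₁ := ⟨x₀⟩
  have : Nonempty Y₁ := ⟨y₀⟩
  set c := lipNumber α f - lipNumber α g with hc
  have k0 : reMax g = reMax f + c := by
    have := hFG 1
    simp only [one_smul, norm_one, one_mul] at this
    linarith
  have kp : reMax (Complex.I • g) = c := by
    have h := hFG Complex.I
    rw [reMax_eq (F := Complex.I • f) (m := 0) (fun x y => by simp [hF]) x₀ y₀ (by simp [hF]),
      Complex.norm_I] at h
    linarith
  have km : reMax ((-Complex.I) • g) = c := by
    have h := hFG (-Complex.I)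
    rw [reMax_eq (F := (-Complex.I) • f) (m := 0) (fun x y => by simp [hF]) x₀ y₀ (by simp [hF]),
      norm_neg, Complex.norm_I] at h
    linarith
  have him : ∀ x y, |(g x y).im| ≤ c := by
    intro x y
    have h1 := re_le_reMax (Complex.I • g) x y
    have h2 := re_le_reMax ((-Complex.I) • g) x y
    rw [kp] at h1
    rw [km] at h2
    simp at h1 h2
    exact abs_le.2 ⟨by linarith, by linarith⟩
  obtain ⟨xm, ym, hxm⟩ := exists_re_eq_reMax (Complex.I • g)
  obtain ⟨xp, yp, hxp⟩ := exists_re_eq_reMax ((-Complex.I) • g)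
  rw [kp] at hxm
  rw [km] at hxp
  replace hxm : -(g xm ym).im = c := by simpa using hxm
  replace hxp : (g xp yp).im = c := by simpa using hxp
  by_contra hne
  have hc0 : 0 < c := by
    have h1 : 0 ≤ c := (abs_nonneg _).trans (him xp yp)
    exact h1.lt_of_ne fun h => hne (by linarith)
  obtain ⟨x, y, hxy⟩ := exists_re_eq_reMax g
  -- The numbers 4 ± 3i have modulus 5, so the invariant bounds 4 Re g ∓ 3 Im g by 4 max f + 5c; at
  -- the maximum of Re g the left side is 4 max f + 4c ∓ 3 Im g.
  have hxyim : |(g x y).im| ≤ c / 3 := by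
    obtain ⟨a, b, hab⟩ := exists_re_eq_reMax f
    have hz : ∀ s : ℝ, s ^ 2 = 1 → ‖(4 + 3 * s * Complex.I : ℂ)‖ = 5 := by
      intro s hs
      have := Complex.sq_norm (4 + 3 * s * Complex.I)
      rw [Complex.normSq_apply] at this
      simp at this
      have h25 : ‖(4 + 3 * s * Complex.I : ℂ)‖ ^ 2 = 5 ^ 2 := by rw [this]; nlinarith
      exact (sq_eq_sq₀ (norm_nonneg _) (by norm_num)).1 h25
    have hs : ∀ s : ℝ, s ^ 2 = 1 → 4 * (g x y).re - 3 * s * (g x y).im ≤ 4 * reMax f + 5 * c := by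
      intro s hs
      have h := hFG (4 + 3 * s * Complex.I)
      have h1 := re_le_reMax ((4 + 3 * s * Complex.I : ℂ) • g) x y
      rw [hz s hs, reMax_eq (F := (4 + 3 * s * Complex.I : ℂ) • f) (m := 4 * reMax f)
        (fun x y => by simpa [hF] using re_le_reMax f x y) a b (by simp [hF, hab])] at h
      simp at h1
      linarith
    have h1 := hs 1 (by norm_num)
    have h2 := hs (-1) (by norm_num)
    exact abs_le.2 ⟨by linarith, by linarith⟩
  -- A contraction, so v = k ∘ g stays in the space. The threshold c/2 lies between c/3 and c: v is
  -- at least c/6 where Re g is maximal and vanishes where |Im g| = c.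
  let k : C(ℂ, ℂ) := ⟨fun z => ((max 0 (c / 2 - |z.im|) : ℝ) : ℂ), by fun_prop⟩
  have hk : ∀ z w, ‖k z - k w‖ ≤ ‖z - w‖ := by
    intro z w
    change ‖((max 0 (c / 2 - |z.im|) : ℝ) : ℂ) - ((max 0 (c / 2 - |w.im|) : ℝ) : ℂ)‖ ≤ _
    rw [← Complex.ofReal_sub, Complex.norm_real, Real.norm_eq_abs]
    refine (abs_max_sub_max_le_max _ _ _ _).trans ?_
    rw [sub_self, abs_zero, max_eq_right (abs_nonneg _), sub_sub_sub_cancel_left, abs_sub_comm]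
    refine (abs_abs_sub_abs_le _ _).trans ?_
    rw [← Complex.sub_im]
    exact Complex.abs_im_le_norm _
  obtain ⟨v, hv⟩ : ∃ v, v = postComp k g := ⟨_, rfl⟩
  have hvA : v ∈ A₂ := hv ▸ hU.type_right.postComp_mem (hg ▸ G.2) k hk
  have hvre : ∀ a b, (v a b).re = max 0 (c / 2 - |(g a b).im|) := fun a b => by
    rw [hv]; exact Complex.ofReal_re _
  have hvim : ∀ a b, (v a b).im = 0 := fun a b => by
    rw [hv]; exact Complex.ofReal_im _
  obtain ⟨H, hH⟩ : ∃ H, U H = ⟨v, hvA⟩ := U.surjective _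
  obtain ⟨w, hw⟩ : ∃ w : C(X₁, C(Y₁, ℂ)), w = H := ⟨_, rfl⟩
  have e1 := fun z : ℂ => hU.reMax_smul_add_lipNumber z (P := F + H) (Q := G + ⟨v, hvA⟩)
    (by rw [map_add, hG, hH])
  have e2 := fun z : ℂ => hU.reMax_smul_add_lipNumber z (P := F + Complex.I • H)
    (Q := G + Complex.I • ⟨v, hvA⟩) (by rw [map_add, map_smul, hG, hH])
  simp only [Submodule.coe_add, Submodule.coe_smul] at e1 e2
  rw [← hf, ← hg, ← hw] at e1 e2
  have b0 : ∀ a b, 0 ≤ (v a b).re := fun a b => (hvre a b).symm ▸ le_max_left _ _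
  have b1 : ∀ a b, |(g a b).im| + (v a b).re ≤ c := by
    intro a b
    rw [hvre]
    rcases max_cases 0 (c / 2 - |(g a b).im|) with h | h
    · linarith [him a b]
    · linarith
  have vm : (v xm ym).re = 0 := by
    have := b1 xm ym
    rw [← abs_neg, hxm, abs_of_pos hc0] at this
    linarith [b0 xm ym]
  have vp : (v xp yp).re = 0 := by
    have := b1 xp yp
    rw [hxp, abs_of_pos hc0] at this
    linarith [b0 xp yp]
  have vx : c / 6 ≤ (v x y).re := by
    rw [hvre]
    exact le_max_of_le_right (by linarith)
  obtain ⟨a, b, hab⟩ := exists_re_eq_reMax f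
  have s1 : reMax (Complex.I • w) =
      c + lipNumber α (g + v) - lipNumber α (f + w) := by
    have h := e1 Complex.I
    rw [Complex.norm_I, reMax_eq (F := Complex.I • (g + v)) (m := c)
      (fun a b => by simpa [hvim] using neg_le.1 (abs_le.1 (him a b)).1) xm ym
      (by simpa [hvim] using hxm)] at h
    have : reMax (Complex.I • (f + w)) = reMax (Complex.I • w) := by simp [reMax, hF]
    linarith
  have s2 : reMax w = c + lipNumber α (g + Complex.I • v) - lipNumber α (f + Complex.I • w) := by
    have h := e2 (-Complex.I)
    rw [norm_neg, Complex.norm_I, reMax_eq (F := (-Complex.I) • (g + Complex.I • v)) (m := c)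
      (fun a b => by
        have h1 := b1 a b
        have h2 := le_abs_self (g a b).im
        simp; linarith) xp yp
      (by simp [vp, hxp])] at h
    have : reMax ((-Complex.I) • (f + Complex.I • w)) = reMax w := by simp [reMax, hF]
    linarith
  have s3 := e1 1
  have s4 := e2 1
  simp only [one_smul, norm_one, one_mul] at s3 s4
  have t1 : reMax f + c + c / 6 ≤ reMax (g + v) := by
    have := re_le_reMax (g + v) x y
    simp only [ContinuousMap.add_apply, Complex.add_re] at this
    linarith
  have t2 : reMax (f + w) ≤ reMax f + reMax w := by
    obtain ⟨a, b, hab⟩ := exists_re_eq_reMax (f + w)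
    rw [← hab]
    exact add_le_add (re_le_reMax f a b) (re_le_reMax w a b)
  have t3 : reMax f + c ≤ reMax (g + Complex.I • v) := by
    have := re_le_reMax (g + Complex.I • v) x y
    simp [hvim] at this
    linarith
  have t4 : reMax (f + Complex.I • w) ≤ reMax f + reMax (Complex.I • w) := by
    obtain ⟨a, b, hab⟩ := exists_re_eq_reMax (f + Complex.I • w)
    rw [← hab]
    exact add_le_add (re_le_reMax f a b) (re_le_reMax (Complex.I • w) a b)
  -- With a = L(g + v) - L(f + w) and b = L(g + iv) - L(f + iw), the relations give b ≥ a + c/6 and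
  -- a ≥ b.
  linarith

theorem reMax_map_of_real (hU : IsUnitalIsometry α U) (F : A₁)
    (hF : ∀ x y, ((F : C(X₁, C(Y₁, ℂ))) x y).im = 0) :
    reMax (U F : C(X₂, C(Y₂, ℂ))) = reMax (F : C(X₁, C(Y₁, ℂ))) := by
  have h := hU.reMax_smul_add_lipNumber 1 (P := F) rfl
  simp only [one_smul, norm_one, one_mul, hU.lipNumber_map_of_real F hF] at h
  linarith

theorem im_map_of_real (hU : IsUnitalIsometry α U) (F : A₁)
    (hF : ∀ x y, ((F : C(X₁, C(Y₁, ℂ))) x y).im = 0) (x : X₂) (y : Y₂) :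
    ((U F : C(X₂, C(Y₂, ℂ))) x y).im = 0 := by
  have key : ∀ z : ℂ, z.re = 0 → ‖z‖ = 1 → (z * (U F : C(X₂, C(Y₂, ℂ))) x y).re ≤ 0 := by
    intro z hz hz1
    have h := hU.reMax_smul_add_lipNumber z (P := F) rfl
    obtain ⟨a⟩ := ‹Nonempty X₁›
    obtain ⟨b⟩ := ‹Nonempty Y₁›
    have : Nonempty X₁ := ⟨a⟩
    have : Nonempty Y₁ := ⟨b⟩
    rw [hU.lipNumber_map_of_real F hF, reMax_eq (F := z • (F : C(X₁, C(Y₁, ℂ)))) (m := 0)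
      (fun x y => by simp [hF, hz]) a b (by simp [hF, hz])] at h
    have h1 := re_le_reMax (z • (U F : C(X₂, C(Y₂, ℂ)))) x y
    simp only [ContinuousMap.smul_apply, smul_eq_mul] at h1
    linarith
  have h1 := key Complex.I (by simp) (by simp)
  have h2 := key (-Complex.I) (by simp) (by simp)
  simp at h1 h2
  linarith

end IsUnitalIsometry

end UnitalIsometry

/-! ### Unital isometries are composition operators. -/

section Representation

variable {X₁ X₂ Y₁ Y₂ : Type*} [MetricSpace X₁] [CompactSpace X₁] [MetricSpace X₂] [CompactSpace X₂]
  [TopologicalSpace Y₁] [CompactSpace Y₁] [TopologicalSpace Y₂] [CompactSpace Y₂]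

theorem abs_min_dist_sub_le {X : Type*} [MetricSpace X] (a : X) (r : ℝ) (x x' : X) :
    |min (dist x a) r - min (dist x' a) r| ≤ dist x x' := by
  refine (abs_min_sub_min_le_max _ _ _ _).trans ?_
  rw [sub_self, abs_zero]
  exact max_le (abs_dist_sub_le x x' a) dist_nonneg

/-- The truncated distance function `min (d(·, a), r)`, as a map that is constant in `Y`. -/
noncomputable def truncDist {X Y : Type*} [MetricSpace X] [TopologicalSpace Y] (a : X) (r : ℝ) :
    C(X, C(Y, ℂ)) :=
  ContinuousMap.comp ⟨fun z : ℂ => ContinuousMap.const Y z, ContinuousMap.continuous_const'⟩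
    ⟨fun x => ((min (dist x a) r : ℝ) : ℂ), by fun_prop⟩

@[simp] theorem truncDist_apply {X Y : Type*} [MetricSpace X] [TopologicalSpace Y] (a : X) (r : ℝ)
    (x : X) (y : Y) : (truncDist a r : C(X, C(Y, ℂ))) x y = ((min (dist x a) r : ℝ) : ℂ) := rfl

theorem norm_truncDist_sub_le (a : X₁) (r : ℝ) (x x' : X₁) :
    ‖(truncDist a r : C(X₁, C(Y₁, ℂ))) x - truncDist a r x'‖ ≤ 1 * dist x x' := by
  rw [one_mul, ContinuousMap.norm_le _ dist_nonneg]
  intro y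
  rw [ContinuousMap.sub_apply, truncDist_apply, truncDist_apply, ← Complex.ofReal_sub,
    Complex.norm_real]
  exact abs_min_dist_sub_le a r x x'

theorem lipNumber_truncDist_le {α : ℝ} (hα : 0 < α) (hα1 : α ≤ 1) (a : X₁) {r : ℝ} (hr : 0 < r) :
    lipNumber α (truncDist a r : C(X₁, C(Y₁, ℂ))) ≤ r ^ (1 - α) := by
  refine lipNumber_le (Real.rpow_nonneg hr.le _) fun x x' y => ?_
  by_cases hx : x = x'
  · subst hx; simpa [diffQuot] using Real.rpow_nonneg hr.le _
  have hd : 0 < dist x x' := dist_pos.2 hx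
  rw [norm_diffQuot, div_le_iff₀ (Real.rpow_pos_of_pos hd α), truncDist_apply, truncDist_apply,
    ← Complex.ofReal_sub, Complex.norm_real, Real.norm_eq_abs]
  have h1 := abs_min_dist_sub_le a r x x'
  have h2 : |min (dist x a) r - min (dist x' a) r| ≤ r := by
    have := dist_nonneg (x := x) (y := a)
    have := dist_nonneg (x := x') (y := a)
    have g1 : 0 ≤ min (dist x a) r := le_min (by assumption) hr.le
    have g2 : 0 ≤ min (dist x' a) r := le_min (by assumption) hr.le
    have g3 := min_le_right (dist x a) r
    have g4 := min_le_right (dist x' a) r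
    exact abs_le.2 ⟨by linarith, by linarith⟩
  set t := |min (dist x a) r - min (dist x' a) r| with ht
  rcases (abs_nonneg (min (dist x a) r - min (dist x' a) r)).eq_or_lt with h0 | h0
  · rw [ht, ← h0]; positivity
  · rw [← ht] at h0
    calc t = t ^ (1 - α) * t ^ α := by
          rw [← Real.rpow_add h0]; simp
      _ ≤ r ^ (1 - α) * dist x x' ^ α :=
          mul_le_mul (Real.rpow_le_rpow h0.le h2 (by linarith))
            (Real.rpow_le_rpow h0.le h1 hα.le) (Real.rpow_nonneg h0.le _)
            (Real.rpow_nonneg hr.le _)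

/-- By Urysohn's lemma the real continuous functions determine the topology of a compact Hausdorff
space. -/
theorem continuous_of_forall_comp {Z Y : Type*} [TopologicalSpace Z] [TopologicalSpace Y]
    [CompactSpace Y] [T2Space Y] {σ : Z → Y}
    (h : ∀ g : C(Y, ℝ), Continuous fun z => g (σ z)) : Continuous σ := by
  rw [continuous_iff_continuousAt]
  intro z
  rw [ContinuousAt, tendsto_nhds]
  intro O hO hz
  obtain ⟨g, hg0, hg1, -⟩ := exists_continuous_zero_one_of_isClosed
    (isClosed_singleton (x := σ z)) hO.isClosed_compl
    (by simpa [disjoint_singleton_left] using hz)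
  have h0 : g (σ z) = 0 := hg0 rfl
  have : ∀ᶠ w in 𝓝 z, g (σ w) < 1 := (h g).continuousAt.eventually_lt continuousAt_const (by simp [h0])
  filter_upwards [this] with w hw
  by_contra hwO
  have h1 : g (σ w) = 1 := hg1 hwO
  linarith

/-- A real function on `Y`, as a complex map on `X` that is constant in `X`. -/
noncomputable def constReal (X : Type*) {Y : Type*} [TopologicalSpace X] [TopologicalSpace Y]
    (g : C(Y, ℝ)) : C(X, C(Y, ℂ)) :=
  ContinuousMap.const X (ContinuousMap.comp ⟨fun t : ℝ => (t : ℂ), by fun_prop⟩ g)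

@[simp] theorem constReal_apply {X Y : Type*} [TopologicalSpace X] [TopologicalSpace Y]
    (g : C(Y, ℝ)) (x : X) (y : Y) : constReal X g x y = (g y : ℂ) := rfl

namespace IsUnitalIsometry

variable {α : ℝ} {A₁ : Submodule ℂ C(X₁, C(Y₁, ℂ))} {A₂ : Submodule ℂ C(X₂, C(Y₂, ℂ))}
  {U : A₁ ≃ₗ[ℂ] A₂} [Nonempty X₁] [Nonempty X₂] [Nonempty Y₁] [Nonempty Y₂]

/-- The conditions on p are closed. Finitely many can be met together: the sum of maps peaking at
(x, y) also peaks there, its preimage attains the same maximum, and at such a point every summand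
must attain its own bound. Compactness does the rest. -/
theorem exists_peak_point (hU : IsUnitalIsometry α U) (x : X₂) (y : Y₂) :
    ∃ p : X₁ × Y₁, ∀ V : A₂, (∀ a b, ((V : C(X₂, C(Y₂, ℂ))) a b).im = 0) →
      ((V : C(X₂, C(Y₂, ℂ))) x y).re = reMax (V : C(X₂, C(Y₂, ℂ))) →
      ((U.symm V : C(X₁, C(Y₁, ℂ))) p.1 p.2).re = ((V : C(X₂, C(Y₂, ℂ))) x y).re := by
  let ι := {V : A₂ // (∀ a b, ((V : C(X₂, C(Y₂, ℂ))) a b).im = 0) ∧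
      ((V : C(X₂, C(Y₂, ℂ))) x y).re = reMax (V : C(X₂, C(Y₂, ℂ)))}
  let Z : ι → Set (X₁ × Y₁) := fun V =>
    {p | ((U.symm V.1 : C(X₁, C(Y₁, ℂ))) p.1 p.2).re = ((V.1 : C(X₂, C(Y₂, ℂ))) x y).re}
  have hZ : (⋂ i, Z i).Nonempty := by
    refine CompactSpace.iInter_nonempty (fun V => ?_) fun s => ?_
    · exact isClosed_eq (Complex.continuous_re.comp (continuous_apply_pair _)) continuous_const
    · let S : A₂ := ∑ V ∈ s, V.1
      have hS : ∀ a b, (S : C(X₂, C(Y₂, ℂ))) a b = ∑ V ∈ s, (V.1 : C(X₂, C(Y₂, ℂ))) a b := by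
        intro a b
        simp [S, ContinuousMap.sum_apply]
      have hUS : ∀ a b, (U.symm S : C(X₁, C(Y₁, ℂ))) a b =
          ∑ V ∈ s, (U.symm V.1 : C(X₁, C(Y₁, ℂ))) a b := by
        intro a b
        rw [show U.symm S = ∑ V ∈ s, U.symm V.1 from map_sum U.symm.toLinearMap _ _]
        simp [ContinuousMap.sum_apply]
      have hSmax : reMax (S : C(X₂, C(Y₂, ℂ))) = ∑ V ∈ s, ((V.1 : C(X₂, C(Y₂, ℂ))) x y).re := by
        refine reMax_eq (fun a b => ?_) x y (by rw [hS, Complex.re_sum])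
        rw [hS, Complex.re_sum]
        exact Finset.sum_le_sum fun V _ => V.2.2 ▸ re_le_reMax _ a b
      have hle : ∀ a b, ∀ V ∈ s, ((U.symm V.1 : C(X₁, C(Y₁, ℂ))) a b).re ≤
          ((V.1 : C(X₂, C(Y₂, ℂ))) x y).re := by
        intro a b V _
        rw [V.2.2, ← hU.symm.reMax_map_of_real V.1 V.2.1]
        exact re_le_reMax _ a b
      obtain ⟨a, b, hab⟩ := exists_re_eq_reMax (U.symm S : C(X₁, C(Y₁, ℂ)))
      rw [hU.symm.reMax_map_of_real S (fun a b => by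
        rw [hS, Complex.im_sum]; exact Finset.sum_eq_zero fun V _ => V.2.1 a b), hSmax, hUS,
        Complex.re_sum] at hab
      have heq := (Finset.sum_eq_sum_iff_of_le (hle a b)).1 hab
      exact ⟨(a, b), mem_iInter₂.2 fun V hV => heq V hV⟩
  obtain ⟨p, hp⟩ := hZ
  exact ⟨p, fun V h1 h2 => mem_iInter.1 hp ⟨V, h1, h2⟩⟩

theorem exists_point_of_real (hU : IsUnitalIsometry α U) (x : X₂) (y : Y₂) :
    ∃ p : X₁ × Y₁, ∀ V : A₂, (∀ a b, ((V : C(X₂, C(Y₂, ℂ))) a b).im = 0) →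
      (U.symm V : C(X₁, C(Y₁, ℂ))) p.1 p.2 = (V : C(X₂, C(Y₂, ℂ))) x y := by
  obtain ⟨p, hp⟩ := hU.exists_peak_point x y
  refine ⟨p, fun V hV => ?_⟩
  obtain ⟨c, hc⟩ : ∃ c, c = (V : C(X₂, C(Y₂, ℂ))) x y := ⟨_, rfl⟩
  have hcim : c.im = 0 := hc ▸ hV x y
  -- With W = -|V - c|, both W and V + W peak at (x, y), with values 0 and c. Subtracting gives the
  -- value for an arbitrary real V.
  let k : C(ℂ, ℂ) := ⟨fun z => ((-‖z - c‖ : ℝ) : ℂ), by fun_prop⟩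
  have hk : ∀ z w, ‖k z - k w‖ ≤ ‖z - w‖ := by
    intro z w
    change ‖((-‖z - c‖ : ℝ) : ℂ) - ((-‖w - c‖ : ℝ) : ℂ)‖ ≤ _
    rw [← Complex.ofReal_sub, Complex.norm_real, Real.norm_eq_abs, ← abs_neg]
    have : -(-‖z - c‖ - -‖w - c‖) = ‖z - c‖ - ‖w - c‖ := by ring
    rw [this]
    exact (abs_norm_sub_norm_le _ _).trans_eq (by rw [sub_sub_sub_cancel_right])
  let W : A₂ := ⟨postComp k V, hU.type_right.postComp_mem V.2 k hk⟩
  have hWr : ∀ a b, ((W : C(X₂, C(Y₂, ℂ))) a b).re = -‖(V : C(X₂, C(Y₂, ℂ))) a b - c‖ :=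
    fun a b => Complex.ofReal_re _
  have hWi : ∀ a b, ((W : C(X₂, C(Y₂, ℂ))) a b).im = 0 := fun a b => Complex.ofReal_im _
  have hW0 : ((W : C(X₂, C(Y₂, ℂ))) x y).re = 0 := by rw [hWr, hc]; simp
  have h1 := hp W hWi (by
    rw [hW0, reMax_eq (fun a b => (hWr a b).trans_le (neg_nonpos.2 (norm_nonneg _))) x y hW0])
  have hVW : ∀ a b, (((V + W : A₂) : C(X₂, C(Y₂, ℂ))) a b).re =
      ((V : C(X₂, C(Y₂, ℂ))) a b).re - ‖(V : C(X₂, C(Y₂, ℂ))) a b - c‖ := by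
    intro a b
    rw [sub_eq_add_neg, ← hWr]; rfl
  have hVW0 : (((V + W : A₂) : C(X₂, C(Y₂, ℂ))) x y).re = c.re := by
    rw [hVW, ← hc]; simp
  have h2 := hp (V + W) (fun a b => by simp [hV, hWi]) (by
    rw [hVW0, reMax_eq (fun a b => ?_) x y hVW0]
    rw [hVW]
    have := Complex.re_le_norm ((V : C(X₂, C(Y₂, ℂ))) a b - c)
    rw [Complex.sub_re] at this
    linarith)
  rw [hVW0, map_add] at h2
  rw [hW0] at h1
  refine Complex.ext ?_ ?_
  · simp only [Submodule.coe_add, ContinuousMap.add_apply, Complex.add_re, h1] at h2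
    rw [← hc]; linarith
  · rw [hU.symm.im_map_of_real V hV, hV]

theorem exists_point (hU : IsUnitalIsometry α U) (x : X₂) (y : Y₂) :
    ∃ p : X₁ × Y₁, ∀ F : A₁,
      (U F : C(X₂, C(Y₂, ℂ))) x y = (F : C(X₁, C(Y₁, ℂ))) p.1 p.2 := by
  obtain ⟨p, hp⟩ := hU.exists_point_of_real x y
  have hreal : ∀ F : A₁, (∀ a b, ((F : C(X₁, C(Y₁, ℂ))) a b).im = 0) →
      (U F : C(X₂, C(Y₂, ℂ))) x y = (F : C(X₁, C(Y₁, ℂ))) p.1 p.2 := by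
    intro F hF
    rw [← hp (U F) (hU.im_map_of_real F hF), LinearEquiv.symm_apply_apply]
  refine ⟨p, fun F => ?_⟩
  let P : A₁ := ⟨postComp reMap F, hU.type_left.postComp_mem F.2 _ norm_reMap_sub_le⟩
  let Q : A₁ := ⟨postComp reMap ((-Complex.I) • (F : C(X₁, C(Y₁, ℂ)))),
    hU.type_left.postComp_mem (A₁.smul_mem _ F.2) _ norm_reMap_sub_le⟩
  have hF : F = P + Complex.I • Q := by
    apply Subtype.ext
    ext a b
    refine Complex.ext ?_ ?_ <;> simp [P, Q]
  have hP := hreal P fun a b => Complex.ofReal_im _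
  have hQ := hreal Q fun a b => Complex.ofReal_im _
  rw [hF, map_add, map_smul]
  simp only [Submodule.coe_add, Submodule.coe_smul, ContinuousMap.add_apply,
    ContinuousMap.smul_apply, hP, hQ]

variable [T2Space Y₁] [T2Space Y₂]

/-- A real function of y alone has Lipschitz number 0, hence so does its image, which is therefore
constant in x; Urysohn functions separate distinct second coordinates. -/
theorem snd_eq_of_point (hU : IsUnitalIsometry α U) {Φ : X₂ → Y₂ → X₁ × Y₁}
    (hΦ : ∀ x y, ∀ F : A₁,
      (U F : C(X₂, C(Y₂, ℂ))) x y = (F : C(X₁, C(Y₁, ℂ))) (Φ x y).1 (Φ x y).2)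
    (x x' : X₂) (y : Y₂) : (Φ x y).2 = (Φ x' y).2 := by
  by_contra hne
  obtain ⟨g, hg0, hg1, -⟩ := exists_continuous_zero_one_of_isClosed
    (isClosed_singleton (x := (Φ x y).2)) (isClosed_singleton (x := (Φ x' y).2)) (by simpa using hne)
  let F : A₁ := ⟨constReal X₁ g, hU.type_left.const_mem _⟩
  have h := hU.lipNumber_map_of_real F fun a b => Complex.ofReal_im _
  rw [show lipNumber α (F : C(X₁, C(Y₁, ℂ))) = 0 from lipNumber_const _ _] at h
  have h1 := norm_diffQuot_le (hU.type_right.le_lipSpace (U F).2) x x' y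
  have hx : x ≠ x' := fun h => hne (by rw [h])
  rw [h, norm_diffQuot, div_le_iff₀ (Real.rpow_pos_of_pos (dist_pos.2 hx) α), zero_mul,
    norm_le_zero_iff, hΦ, hΦ] at h1
  have e0 : g (Φ x y).2 = 0 := hg0 rfl
  have e1 : g (Φ x' y).2 = 1 := hg1 rfl
  simp [F, e0, e1] at h1

theorem dist_fst_le_of_point (hU : IsUnitalIsometry α U) (hα : 0 < α) (hα1 : α ≤ 1)
    {Φ : X₂ → Y₂ → X₁ × Y₁}
    (hΦ : ∀ x y, ∀ F : A₁,
      (U F : C(X₂, C(Y₂, ℂ))) x y = (F : C(X₁, C(Y₁, ℂ))) (Φ x y).1 (Φ x y).2)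
    (x x' : X₂) (y : Y₂) : dist (Φ x y).1 (Φ x' y).1 ≤ dist x x' := by
  by_cases hx : x = x'
  · subst hx; simp
  rcases (dist_nonneg (x := (Φ x y).1) (y := (Φ x' y).1)).eq_or_lt with h0 | hr
  · rw [← h0]; exact dist_nonneg
  set r := dist (Φ x y).1 (Φ x' y).1 with hrdef
  -- Truncation at height r keeps L(F) ≤ r^(1-α), while U(F) changes by exactly r between x and x'.
  -- So r ≤ r^(1-α) d(x, x')^α, which is sharp enough to give r ≤ d(x, x').
  let F : A₁ := ⟨truncDist (Φ x' y).1 r,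
    hU.type_left.mem_of_lipschitz _ 1 (norm_truncDist_sub_le _ _)⟩
  have h := hU.lipNumber_map_of_real F fun a b => Complex.ofReal_im _
  have h1 := norm_diffQuot_le (hU.type_right.le_lipSpace (U F).2) x x' y
  have h2 : lipNumber α (F : C(X₁, C(Y₁, ℂ))) ≤ r ^ (1 - α) := lipNumber_truncDist_le hα hα1 _ hr
  have hd := dist_pos.2 hx
  rw [h, norm_diffQuot, div_le_iff₀ (Real.rpow_pos_of_pos hd α), hΦ, hΦ] at h1
  simp only [F, truncDist_apply, ← hrdef, dist_self, min_self, min_eq_left hr.le,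
    Complex.ofReal_zero, sub_zero, Complex.norm_real, Real.norm_of_nonneg hr.le] at h1
  have h3 : r ≤ r ^ (1 - α) * dist x x' ^ α :=
    h1.trans (mul_le_mul_of_nonneg_right h2 (Real.rpow_nonneg hd.le _))
  have h4 : r ^ (1 - α) * r ^ α = r := by rw [← Real.rpow_add hr]; simp
  have h5 : r ^ (1 - α) * r ^ α ≤ r ^ (1 - α) * dist x x' ^ α := by rwa [h4]
  have h6 := le_of_mul_le_mul_left h5 (Real.rpow_pos_of_pos hr _)
  exact (Real.rpow_le_rpow_iff hr.le hd.le hα).1 h6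

theorem point_unique (hU : IsUnitalIsometry α U) {p q : X₁ × Y₁}
    (h : ∀ F : A₁, (F : C(X₁, C(Y₁, ℂ))) p.1 p.2 = (F : C(X₁, C(Y₁, ℂ))) q.1 q.2) : p = q := by
  refine Prod.ext ?_ ?_
  · by_contra hne
    have hd := dist_pos.2 hne
    have := h ⟨truncDist q.1 (dist p.1 q.1),
      hU.type_left.mem_of_lipschitz _ 1 (norm_truncDist_sub_le _ _)⟩
    simp [dist_nonneg] at this
    exact hne this
  · by_contra hne
    obtain ⟨g, hg0, hg1, -⟩ := exists_continuous_zero_one_of_isClosed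
      (isClosed_singleton (x := p.2)) (isClosed_singleton (x := q.2)) (by simpa using hne)
    have := h ⟨constReal X₁ g, hU.type_left.const_mem _⟩
    have e0 : g p.2 = 0 := hg0 rfl
    have e1 : g q.2 = 1 := hg1 rfl
    simp [e0, e1] at this

theorem exists_composition_form (hU : IsUnitalIsometry α U) (hα : 0 < α) (hα1 : α ≤ 1) :
    ∃ (φ : C(X₂ × Y₂, X₁)) (τ : Y₂ ≃ₜ Y₁),
      (∀ y : Y₂, Isometry (fun x : X₂ => φ (x, y)) ∧
        Function.Surjective (fun x : X₂ => φ (x, y))) ∧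
      ∀ (F : A₁) (x : X₂) (y : Y₂),
        (U F : C(X₂, C(Y₂, ℂ))) x y = (F : C(X₁, C(Y₁, ℂ))) (φ (x, y)) (τ y) := by
  choose Φ hΦ using hU.exists_point
  choose Ψ hΨ using hU.symm.exists_point
  have hΦΨ : ∀ a b, Φ (Ψ a b).1 (Ψ a b).2 = (a, b) := fun a b =>
    hU.point_unique fun F => by
      rw [← hΦ, ← hΨ, LinearEquiv.symm_apply_apply]
  have hΨΦ : ∀ x y, Ψ (Φ x y).1 (Φ x y).2 = (x, y) := fun x y =>
    hU.symm.point_unique fun F => by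
      rw [← hΨ, ← hΦ, LinearEquiv.apply_symm_apply]
  obtain ⟨x₀⟩ := ‹Nonempty X₂›
  obtain ⟨a₀⟩ := ‹Nonempty X₁›
  have : Nonempty X₁ := ⟨a₀⟩
  have : Nonempty X₂ := ⟨x₀⟩
  have hs : ∀ x y, (Φ x y).2 = (Φ x₀ y).2 := fun x y => hU.snd_eq_of_point hΦ x x₀ y
  have ht : ∀ a b, (Ψ a b).2 = (Ψ a₀ b).2 := fun a b => hU.symm.snd_eq_of_point hΨ a a₀ b
  have hτ : Continuous fun y => (Φ x₀ y).2 := by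
    refine continuous_of_forall_comp fun g => ?_
    have h := Complex.continuous_re.comp
      ((U ⟨constReal X₁ g, hU.type_left.const_mem _⟩ : C(X₂, C(Y₂, ℂ))) x₀).continuous
    refine h.congr fun y => ?_
    simp [hΦ]
  have hτ' : Continuous fun b => (Ψ a₀ b).2 := by
    refine continuous_of_forall_comp fun g => ?_
    have h := Complex.continuous_re.comp
      ((U.symm ⟨constReal X₂ g, hU.type_right.const_mem _⟩ : C(X₁, C(Y₁, ℂ))) a₀).continuous
    refine h.congr fun y => ?_
    simp [hΨ]
  have hφ : Continuous fun p : X₂ × Y₂ => (Φ p.1 p.2).1 := by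
    rw [continuous_iff_continuousAt]
    intro q
    rw [ContinuousAt, tendsto_iff_dist_tendsto_zero, Metric.tendsto_nhds]
    intro ε hε
    -- U(F) is continuous and vanishes at q; a value below ε means that the first coordinate has
    -- moved by less than ε.
    let F : A₁ := ⟨truncDist (Φ q.1 q.2).1 ε,
      hU.type_left.mem_of_lipschitz _ 1 (norm_truncDist_sub_le _ _)⟩
    have h := (Complex.continuous_re.comp
      (continuous_apply_pair (U F : C(X₂, C(Y₂, ℂ))))).continuousAt (x := q)
    have h' : ∀ᶠ p in 𝓝 q, ((U F : C(X₂, C(Y₂, ℂ))) p.1 p.2).re < ε :=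
      h.eventually_lt continuousAt_const (by simp [hΦ, F, hε.le, hε])
    filter_upwards [h'] with p hp
    rw [hΦ] at hp
    simp only [F, truncDist_apply, Complex.ofReal_re] at hp
    rw [Real.dist_eq, sub_zero, abs_of_nonneg dist_nonneg]
    by_contra hlt
    rw [min_eq_right (not_lt.1 hlt)] at hp
    exact lt_irrefl _ hp
  refine ⟨⟨fun p => (Φ p.1 p.2).1, hφ⟩,
    { toFun := fun y => (Φ x₀ y).2
      invFun := fun b => (Ψ a₀ b).2
      left_inv := fun y => ?_
      right_inv := fun b => ?_
      continuous_toFun := hτ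
      continuous_invFun := hτ' }, fun y => ⟨?_, ?_⟩, fun F x y => ?_⟩
  · show (Ψ a₀ (Φ x₀ y).2).2 = y
    rw [← ht (Φ x₀ y).1, hΨΦ]
  · show (Φ x₀ (Ψ a₀ b).2).2 = b
    rw [← hs (Ψ a₀ b).1, hΦΨ]
  · refine Isometry.of_dist_eq fun x x' => le_antisymm (hU.dist_fst_le_of_point hα hα1 hΦ x x' y) ?_
    have h := hU.symm.dist_fst_le_of_point hα hα1 hΨ (Φ x y).1 (Φ x' y).1 (Φ x y).2
    rw [hΨΦ, hs x y, ← hs x' y, hΨΦ] at h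
    exact h
  · intro a
    refine ⟨(Ψ a (Φ x₀ y).2).1, ?_⟩
    have h1 : (Ψ a (Φ x₀ y).2).2 = y := by
      rw [ht, ← ht (Φ x₀ y).1, hΨΦ]
    have h2 := hΦΨ a (Φ x₀ y).2
    rw [h1] at h2
    exact congrArg Prod.fst h2
  · rw [hΦ, hs x y]; rfl

end IsUnitalIsometry

end Representation

/-! ### Reduction of a general isometry to a unital one. -/

section Isometries

variable {X₁ X₂ Y₁ Y₂ : Type*} [MetricSpace X₁] [CompactSpace X₁] [MetricSpace X₂] [CompactSpace X₂]
  [TopologicalSpace Y₁] [CompactSpace Y₁] [TopologicalSpace Y₂] [CompactSpace Y₂]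
  {α : ℝ} {A₁ : Submodule ℂ C(X₁, C(Y₁, ℂ))} {A₂ : Submodule ℂ C(X₂, C(Y₂, ℂ))}

/-- The map `x ↦ g · F x`. -/
noncomputable def mulConst (g : C(Y₁, ℂ)) (F : C(X₁, C(Y₁, ℂ))) : C(X₁, C(Y₁, ℂ)) :=
  ⟨fun x => g * F x, continuous_const.mul F.continuous⟩

@[simp] theorem mulConst_apply (g : C(Y₁, ℂ)) (F : C(X₁, C(Y₁, ℂ))) (x : X₁) (y : Y₁) :
    mulConst g F x y = g y * F x y := rfl

theorem norm_mulConst_sub (g : C(Y₁, ℂ)) (hg : ∀ y, ‖g y‖ = 1) (F : C(X₁, C(Y₁, ℂ))) (x x' : X₁) :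
    ‖mulConst g F x - mulConst g F x'‖ = ‖F x - F x'‖ := by
  have h : ∀ y, ‖(mulConst g F x - mulConst g F x') y‖ = ‖(F x - F x') y‖ := by
    intro y
    rw [ContinuousMap.sub_apply, ContinuousMap.sub_apply, mulConst_apply, mulConst_apply,
      ← mul_sub, norm_mul, hg, one_mul]
  refine le_antisymm ?_ ?_
  · rw [ContinuousMap.norm_le _ (norm_nonneg _)]
    exact fun y => (h y).trans_le (ContinuousMap.norm_coe_le_norm _ y)
  · rw [ContinuousMap.norm_le _ (norm_nonneg _)]
    exact fun y => (h y).symm.trans_le (ContinuousMap.norm_coe_le_norm _ y)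

theorem mulConst_mem (hA : IsLipschitzType α A₁) {g : C(Y₁, ℂ)} (hg : ∀ y, ‖g y‖ = 1)
    {F : C(X₁, C(Y₁, ℂ))} (hF : F ∈ A₁) : mulConst g F ∈ A₁ :=
  hA.mem_of_dominated F hF _ fun x x' => (norm_mulConst_sub g hg F x x').le

/-- Multiplication by a unimodular function of `y`. -/
noncomputable def mulEquiv (hA : IsLipschitzType α A₁) (g : C(Y₁, ℂ)) (hg : ∀ y, ‖g y‖ = 1) :
    A₁ ≃ₗ[ℂ] A₁ where
  toFun F := ⟨mulConst g F.1, mulConst_mem hA hg F.2⟩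
  invFun F := ⟨mulConst (star g) F.1,
    mulConst_mem hA (fun y => (norm_star (g y)).trans (hg y)) F.2⟩
  map_add' F G := by
    apply Subtype.ext
    ext x y
    exact mul_add _ _ _
  map_smul' c F := by
    apply Subtype.ext
    ext x y
    exact mul_left_comm _ _ _
  left_inv F := by
    apply Subtype.ext
    ext x y
    change (starRingEnd ℂ) (g y) * (g y * (F : C(X₁, C(Y₁, ℂ))) x y) = _
    rw [← mul_assoc, Complex.conj_mul', hg]; simp
  right_inv F := by
    apply Subtype.ext
    ext x y
    change g y * ((starRingEnd ℂ) (g y) * (F : C(X₁, C(Y₁, ℂ))) x y) = _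
    rw [← mul_assoc, Complex.mul_conj', hg]; simp

theorem mulEquiv_apply (hA : IsLipschitzType α A₁) (g : C(Y₁, ℂ)) (hg : ∀ y, ‖g y‖ = 1) (F : A₁)
    (x : X₁) (y : Y₁) :
    (mulEquiv hA g hg F : C(X₁, C(Y₁, ℂ))) x y = g y * (F : C(X₁, C(Y₁, ℂ))) x y := rfl

theorem sumNorm_mulEquiv (hA : IsLipschitzType α A₁) (g : C(Y₁, ℂ)) (hg : ∀ y, ‖g y‖ = 1)
    (F : A₁) : sumNorm α (mulEquiv hA g hg F : C(X₁, C(Y₁, ℂ))) = sumNorm α (F : C(X₁, C(Y₁, ℂ))) := by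
  have h : ∀ x y, ‖(mulEquiv hA g hg F : C(X₁, C(Y₁, ℂ))) x y‖ = ‖(F : C(X₁, C(Y₁, ℂ))) x y‖ := by
    intro x y
    rw [mulEquiv_apply, norm_mul, hg, one_mul]
  rw [sumNorm, sumNorm]
  congr 1
  · refine le_antisymm ?_ ?_
    · exact norm_le_of_apply_apply (norm_nonneg _) fun x y =>
        (h x y).trans_le (norm_apply_apply_le _ x y)
    · exact norm_le_of_apply_apply (norm_nonneg _) fun x y =>
        (h x y).symm.trans_le (norm_apply_apply_le _ x y)
  · exact lipNumber_congr fun x x' => norm_mulConst_sub g hg F.1 x x'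

theorem sumNorm_of_eq_const (α : ℝ) {F : C(X₁, C(Y₁, ℂ))} {g : C(Y₁, ℂ)}
    (hF : F = ContinuousMap.const X₁ g) : sumNorm α F = ‖F‖ := by
  rw [sumNorm, hF, lipNumber_const, add_zero]

theorem IsSurjectiveSumNormIsometry.injective {U : A₁ → A₂}
    (hU : IsSurjectiveSumNormIsometry α A₁ A₂ U) : Function.Injective U := by
  obtain ⟨hlin, -, hN⟩ := hU
  intro F G hFG
  have h1 := hN (F - G)
  rw [hlin.map_sub, hFG, sub_self] at h1
  have h0 : ((0 : A₂) : C(X₂, C(Y₂, ℂ))) = ContinuousMap.const X₂ (0 : C(Y₂, ℂ)) := rfl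
  have h2 : ‖((F - G : A₁) : C(X₁, C(Y₁, ℂ)))‖ = 0 := by
    rw [sumNorm_of_eq_const α h0, sumNorm, Submodule.coe_zero, norm_zero] at h1
    linarith [norm_nonneg ((F - G : A₁) : C(X₁, C(Y₁, ℂ))),
      lipNumber_nonneg α ((F - G : A₁) : C(X₁, C(Y₁, ℂ)))]
  exact sub_eq_zero.1 (Subtype.ext (norm_eq_zero.1 h2))

theorem isEmpty_of_equiv [Nonempty X₁] (hA₁ : IsLipschitzType α A₁) (V : A₁ ≃ₗ[ℂ] A₂)
    [IsEmpty Y₂] : IsEmpty Y₁ := by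
  refine ⟨fun y => ?_⟩
  obtain ⟨x⟩ := ‹Nonempty X₁›
  have h : V ⟨1, hA₁.one_mem⟩ = V 0 := by
    apply Subtype.ext
    ext x y
    exact isEmptyElim y
  have h1 := congrArg (fun F : A₁ => (F : C(X₁, C(Y₁, ℂ))) x y) (V.injective h)
  simp at h1

theorem exists_weighted_composition_form [Nonempty X₁] [Nonempty X₂] [T2Space Y₁] [T2Space Y₂]
    (hα : 0 < α) (hα1 : α ≤ 1) (hA₁ : IsLipschitzType α A₁) (hA₂ : IsLipschitzType α A₂)
    {U : A₁ → A₂} (hU : IsSurjectiveSumNormIsometry α A₁ A₂ U) :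
    ∃ (h : C(Y₂, ℂ)) (φ : C(X₂ × Y₂, X₁)) (τ : Y₂ ≃ₜ Y₁),
      (∀ y : Y₂, ‖h y‖ = 1) ∧
      (∀ y : Y₂, Isometry (fun x : X₂ => φ (x, y)) ∧
        Function.Surjective (fun x : X₂ => φ (x, y))) ∧
      ∀ (F : A₁) (x : X₂) (y : Y₂),
        (U F : C(X₂, C(Y₂, ℂ))) x y = h y * (F : C(X₁, C(Y₁, ℂ))) (φ (x, y)) (τ y) := by
  obtain ⟨V, hVU⟩ : ∃ V : A₁ ≃ₗ[ℂ] A₂, ∀ F, V F = U F :=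
    ⟨LinearEquiv.ofBijective (IsLinearMap.mk' U hU.1) ⟨hU.injective, hU.2.1⟩, fun F => rfl⟩
  have hN : ∀ F, sumNorm α (V F : C(X₂, C(Y₂, ℂ))) = sumNorm α (F : C(X₁, C(Y₁, ℂ))) := fun F => by
    rw [hVU]; exact hU.2.2 F
  rcases isEmpty_or_nonempty Y₂ with hY₂ | hY₂
  -- If one of the Y's is empty, its function space is zero, so the other is empty too and the
  -- conclusion is vacuous.
  · have hY₁ := isEmpty_of_equiv hA₁ V
    exact ⟨0, ⟨fun p => isEmptyElim p.2, by
        rw [continuous_iff_continuousAt]; exact fun p => isEmptyElim p.2⟩,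
      Homeomorph.empty, fun y => isEmptyElim y, fun y => isEmptyElim y,
      fun F x y => isEmptyElim y⟩
  have hY₁ : Nonempty Y₁ := by
    by_contra hne
    have : IsEmpty Y₁ := not_nonempty_iff.1 hne
    have := isEmpty_of_equiv hA₂ V.symm
    exact (not_isEmpty_iff.2 hY₂) this
  let e₁ : A₁ := ⟨1, hA₁.one_mem⟩
  have hu1 : sumNorm α (V e₁ : C(X₂, C(Y₂, ℂ))) = 1 := by
    rw [hN]
    have : (e₁ : C(X₁, C(Y₁, ℂ))) = ContinuousMap.const X₁ (1 : C(Y₁, ℂ)) := rfl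
    rw [sumNorm_of_eq_const α this]
    exact norm_one
  obtain ⟨h, hh, hV1⟩ := exists_unimodular_of_spear hA₂ (V e₁).2 hu1 (by
    intro G hG
    obtain ⟨c, hc, hcN⟩ := exists_sumNorm_add_one α (V.symm ⟨G, hG⟩ : C(X₁, C(Y₁, ℂ)))
    refine ⟨c, hc, ?_⟩
    have h1 := hN (V.symm ⟨G, hG⟩ + c • e₁)
    have h2 := hN (V.symm ⟨G, hG⟩)
    rw [map_add, map_smul, LinearEquiv.apply_symm_apply] at h1
    rw [LinearEquiv.apply_symm_apply] at h2
    have h3 : ((V.symm ⟨G, hG⟩ + c • e₁ : A₁) : C(X₁, C(Y₁, ℂ))) =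
      (V.symm ⟨G, hG⟩ : C(X₁, C(Y₁, ℂ))) + c • 1 := rfl
    rw [h3, hcN, ← h2] at h1
    exact h1)
  have hhs : ∀ y, ‖star h y‖ = 1 := fun y => by simp [hh]
  have hconj : ∀ y, h y * star h y = 1 := fun y => by
    have : star h y = (starRingEnd ℂ) (h y) := rfl
    rw [this, Complex.mul_conj, Complex.normSq_eq_norm_sq, hh]; simp
  have hW : IsUnitalIsometry α (V.trans (mulEquiv hA₂ (star h) hhs)) :=
    { type_left := hA₁
      type_right := hA₂
      sumNorm_map := fun F => by
        rw [LinearEquiv.trans_apply, sumNorm_mulEquiv, hN]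
      map_one := by
        apply Subtype.ext
        ext x y
        rw [LinearEquiv.trans_apply, mulEquiv_apply]
        have : (V e₁ : C(X₂, C(Y₂, ℂ))) x y = h y := by rw [hV1]; rfl
        rw [this, mul_comm, hconj]
        rfl }
  obtain ⟨φ, τ, hφ, hform⟩ := hW.exists_composition_form hα hα1
  refine ⟨h, φ, τ, hh, hφ, fun F x y => ?_⟩
  rw [← hform, LinearEquiv.trans_apply, mulEquiv_apply, ← mul_assoc, hconj, one_mul, hVU]

end Isometries

/-! ### Weighted compositions are isometries; fiberwise inversion. -/

section Converse

variable {X₁ X₂ Y₁ Y₂ : Type*} [MetricSpace X₁] [CompactSpace X₁] [MetricSpace X₂] [CompactSpace X₂]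
  [TopologicalSpace Y₁] [CompactSpace Y₁] [TopologicalSpace Y₂] [CompactSpace Y₂]
  {α : ℝ} {A₁ : Submodule ℂ C(X₁, C(Y₁, ℂ))} {A₂ : Submodule ℂ C(X₂, C(Y₂, ℂ))}
  {U : A₁ → A₂} {h : C(Y₂, ℂ)} {φ : C(X₂ × Y₂, X₁)} {τ : Y₂ ≃ₜ Y₁}

theorem isLinearMap_of_form
    (hform : ∀ (F : A₁) (x : X₂) (y : Y₂),
      (U F : C(X₂, C(Y₂, ℂ))) x y = h y * (F : C(X₁, C(Y₁, ℂ))) (φ (x, y)) (τ y)) :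
    IsLinearMap ℂ U where
  map_add F G := by
    apply Subtype.ext
    ext x y
    simp only [Submodule.coe_add, ContinuousMap.add_apply, hform]; ring
  map_smul c F := by
    apply Subtype.ext
    ext x y
    simp only [Submodule.coe_smul, ContinuousMap.smul_apply, hform, smul_eq_mul]; ring

theorem sumNorm_eq_of_form (hA₁ : A₁ ≤ LipSpace α X₁ C(Y₁, ℂ)) (hA₂ : A₂ ≤ LipSpace α X₂ C(Y₂, ℂ))
    (hh : ∀ y : Y₂, ‖h y‖ = 1)
    (hφ : ∀ y : Y₂, Isometry (fun x : X₂ => φ (x, y)) ∧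
      Function.Surjective (fun x : X₂ => φ (x, y)))
    (hform : ∀ (F : A₁) (x : X₂) (y : Y₂),
      (U F : C(X₂, C(Y₂, ℂ))) x y = h y * (F : C(X₁, C(Y₁, ℂ))) (φ (x, y)) (τ y)) (F : A₁) :
    sumNorm α (U F : C(X₂, C(Y₂, ℂ))) = sumNorm α (F : C(X₁, C(Y₁, ℂ))) := by
  have hd : ∀ x x' y, ‖diffQuot α (U F : C(X₂, C(Y₂, ℂ))) x x' y‖ =
      ‖diffQuot α (F : C(X₁, C(Y₁, ℂ))) (φ (x, y)) (φ (x', y)) (τ y)‖ := by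
    intro x x' y
    rw [norm_diffQuot, norm_diffQuot, hform, hform, ← mul_sub, norm_mul, hh, one_mul]
    have : dist (φ (x, y)) (φ (x', y)) = dist x x' := (hφ y).1.dist_eq x x'
    rw [this]
  have hn : ∀ x y, ‖(U F : C(X₂, C(Y₂, ℂ))) x y‖ = ‖(F : C(X₁, C(Y₁, ℂ))) (φ (x, y)) (τ y)‖ := by
    intro x y
    rw [hform, norm_mul, hh, one_mul]
  rw [sumNorm, sumNorm]
  congr 1
  · refine le_antisymm ?_ ?_
    · exact norm_le_of_apply_apply (norm_nonneg _) fun x y =>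
        (hn x y).trans_le (norm_apply_apply_le _ _ _)
    · refine norm_le_of_apply_apply (norm_nonneg _) fun a b => ?_
      obtain ⟨y, rfl⟩ := τ.surjective b
      obtain ⟨x, rfl⟩ := (hφ y).2 a
      exact (hn x y).symm.trans_le (norm_apply_apply_le _ _ _)
  · refine le_antisymm ?_ ?_
    · exact lipNumber_le (lipNumber_nonneg _ _) fun x x' y =>
        (hd x x' y).trans_le (norm_diffQuot_le (hA₁ F.2) _ _ _)
    · refine lipNumber_le (lipNumber_nonneg _ _) fun a a' b => ?_
      obtain ⟨y, rfl⟩ := τ.surjective b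
      obtain ⟨x, rfl⟩ := (hφ y).2 a
      obtain ⟨x', rfl⟩ := (hφ y).2 a'
      exact (hd x x' y).symm.trans_le (norm_diffQuot_le (hA₂ (U F).2) _ _ _)

/-- The map (x, y) ↦ (φ(x, y), y) is a continuous bijection from a compact space to a Hausdorff one,
hence a homeomorphism. -/
theorem exists_fiberwise_inverse [T2Space Y₂]
    (hφ : ∀ y : Y₂, Isometry (fun x : X₂ => φ (x, y)) ∧
      Function.Surjective (fun x : X₂ => φ (x, y))) :
    ∃ ψ : C(X₁ × Y₂, X₂), (∀ a y, φ (ψ (a, y), y) = a) ∧ ∀ x y, ψ (φ (x, y), y) = x := by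
  let f : X₂ × Y₂ → X₁ × Y₂ := fun p => (φ p, p.2)
  have hf : Continuous f := by fun_prop
  have hbij : Function.Bijective f := by
    constructor
    · rintro ⟨x, y⟩ ⟨x', y'⟩ hxy
      obtain ⟨h1, rfl⟩ : φ (x, y) = φ (x', y') ∧ y = y' := by simpa [f] using hxy
      rw [(hφ y).1.injective h1]
    · rintro ⟨a, y⟩
      obtain ⟨x, hx⟩ := (hφ y).2 a
      exact ⟨(x, y), Prod.ext hx rfl⟩
  let e := Continuous.homeoOfEquivCompactToT2 (f := Equiv.ofBijective f hbij) hf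
  have he : ∀ p, f (e.symm p) = p := fun p => e.apply_symm_apply p
  have he' : ∀ p, e.symm (f p) = p := fun p => e.symm_apply_apply p
  refine ⟨⟨fun p => (e.symm p).1, by fun_prop⟩, fun a y => ?_, fun x y => ?_⟩
  · have h1 := he (a, y)
    have h2 : (e.symm (a, y)).2 = y := congrArg Prod.snd h1
    have h3 : φ (e.symm (a, y)) = a := congrArg Prod.fst h1
    have h4 : ((e.symm (a, y)).1, y) = e.symm (a, y) := Prod.ext rfl h2.symm
    exact (congrArg φ h4).trans h3
  · exact congrArg Prod.fst (he' (x, y))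

/-- The map `(a, b) ↦ conj h(τ⁻¹ b) · W(ψ(a, τ⁻¹ b), τ⁻¹ b)`. -/
noncomputable def pullback (h : C(Y₂, ℂ)) (ψ : C(X₁ × Y₂, X₂)) (τ : Y₂ ≃ₜ Y₁)
    (W : C(X₂, C(Y₂, ℂ))) : C(X₁, C(Y₁, ℂ)) :=
  ContinuousMap.curry ⟨fun p : X₁ × Y₁ =>
    star (h (τ.symm p.2)) * W (ψ (p.1, τ.symm p.2)) (τ.symm p.2), by fun_prop⟩

theorem pullback_apply (h : C(Y₂, ℂ)) (ψ : C(X₁ × Y₂, X₂)) (τ : Y₂ ≃ₜ Y₁)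
    (W : C(X₂, C(Y₂, ℂ))) (a : X₁) (y : Y₂) :
    pullback h ψ τ W a (τ y) = star (h y) * W (ψ (a, y)) y := by
  simp [pullback]

theorem norm_pullback_sub {ψ : C(X₁ × Y₂, X₂)} (hh : ∀ y : Y₂, ‖h y‖ = 1) (W : C(X₂, C(Y₂, ℂ)))
    (a a' : X₁) (y : Y₂) :
    ‖pullback h ψ τ W a (τ y) - pullback h ψ τ W a' (τ y)‖ =
      ‖W (ψ (a, y)) y - W (ψ (a', y)) y‖ := by
  rw [pullback_apply, pullback_apply, ← mul_sub, norm_mul, norm_star, hh, one_mul]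

theorem dist_fiberwise_inverse {ψ : C(X₁ × Y₂, X₂)}
    (hφ : ∀ y : Y₂, Isometry (fun x : X₂ => φ (x, y)) ∧
      Function.Surjective (fun x : X₂ => φ (x, y)))
    (hψ : ∀ a y, φ (ψ (a, y), y) = a) (a a' : X₁) (y : Y₂) :
    dist (ψ (a, y)) (ψ (a', y)) = dist a a' := by
  have h1 : dist (φ (ψ (a, y), y)) (φ (ψ (a', y), y)) = dist (ψ (a, y)) (ψ (a', y)) :=
    (hφ y).1.dist_eq _ _
  rw [← h1, hψ, hψ]

theorem pullback_mem_lipSpace {ψ : C(X₁ × Y₂, X₂)} (hh : ∀ y : Y₂, ‖h y‖ = 1)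
    (hψ : ∀ a a' y, dist (ψ (a, y)) (ψ (a', y)) = dist a a') {W : C(X₂, C(Y₂, ℂ))}
    (hW : W ∈ LipSpace α X₂ C(Y₂, ℂ)) : pullback h ψ τ W ∈ LipSpace α X₁ C(Y₁, ℂ) := by
  refine mem_lipSpace_of_diffQuot (lipNumber_nonneg α W) fun a a' b => ?_
  obtain ⟨y, rfl⟩ := τ.surjective b
  refine le_trans (le_of_eq ?_) (norm_diffQuot_le hW (ψ (a, y)) (ψ (a', y)) y)
  rw [norm_diffQuot, norm_diffQuot, norm_pullback_sub hh, hψ]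

theorem map_pullback {ψ : C(X₁ × Y₂, X₂)} (hh : ∀ y : Y₂, ‖h y‖ = 1)
    (hψ : ∀ x y, ψ (φ (x, y), y) = x)
    (hform : ∀ (F : A₁) (x : X₂) (y : Y₂),
      (U F : C(X₂, C(Y₂, ℂ))) x y = h y * (F : C(X₁, C(Y₁, ℂ))) (φ (x, y)) (τ y))
    (W : A₂) (hW : pullback h ψ τ W ∈ A₁) : U ⟨pullback h ψ τ W, hW⟩ = W := by
  apply Subtype.ext
  ext x y
  have : h y * star (h y) = 1 := by
    change h y * (starRingEnd ℂ) (h y) = 1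
    rw [Complex.mul_conj, Complex.normSq_eq_norm_sq, hh]; simp
  rw [hform, pullback_apply, hψ, ← mul_assoc, this, one_mul]

end Converse

/-! ### Little Lipschitz spaces and a function that is not uniformly little Lipschitz. -/

section LittleLipschitz

theorem tendsto_dist_rpow {X : Type*} [MetricSpace X] {s : ℝ} (hs : 0 < s) (x₀ : X) :
    Tendsto (fun x => dist x₀ x ^ s) (𝓝 x₀) (𝓝 0) := by
  have h : ContinuousAt (fun x => dist x₀ x ^ s) x₀ :=
    (continuousAt_const.dist continuousAt_id).rpow_const (Or.inr hs.le)
  simpa [ContinuousAt, Real.zero_rpow hs.ne'] using h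

theorem mem_littleLipSpace_iff {α : ℝ} {K E : Type*} [MetricSpace K] [NormedAddCommGroup E]
    [NormedSpace ℂ E] {F : C(K, E)} :
    F ∈ LittleLipSpace α K E ↔ F ∈ LipSpace α K E ∧
      ∀ x₀, ∀ ε > 0, ∀ᶠ x in 𝓝 x₀, ‖F x₀ - F x‖ ≤ ε * dist x₀ x ^ α := by
  refine and_congr_right fun _ => forall_congr' fun x₀ => ?_
  constructor
  · intro h ε hε
    have h1 := h.eventually (gt_mem_nhds hε)
    rw [eventually_nhdsWithin_iff] at h1
    filter_upwards [h1] with x hx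
    by_cases hxx : x = x₀
    · subst hxx
      simpa using mul_nonneg hε.le (Real.rpow_nonneg le_rfl α)
    · have hd : 0 < dist x₀ x ^ α := Real.rpow_pos_of_pos (dist_pos.2 (Ne.symm hxx)) α
      exact (div_le_iff₀ hd).1 (hx hxx).le
  · intro h
    rw [Metric.tendsto_nhds]
    intro ε hε
    rw [eventually_nhdsWithin_iff]
    filter_upwards [h (ε / 2) (half_pos hε)] with x hx hxx
    have hd : 0 < dist x₀ x ^ α := Real.rpow_pos_of_pos (dist_pos.2 (Ne.symm hxx)) α
    rw [Real.dist_eq, sub_zero, abs_of_nonneg (div_nonneg (norm_nonneg _) hd.le)]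
    exact ((div_le_iff₀ hd).2 hx).trans_lt (half_lt_self hε)

theorem mem_lipSpace_of_norm_sub_le {α C : ℝ} {K E : Type*} [MetricSpace K] [NormedAddCommGroup E]
    [NormedSpace ℂ E] {F : C(K, E)} (h : ∀ x x', ‖F x - F x'‖ ≤ C * dist x x' ^ α) :
    F ∈ LipSpace α K E := by
  refine ⟨C, ?_⟩
  rintro r ⟨x, x', hx, rfl⟩
  exact (div_le_iff₀ (Real.rpow_pos_of_pos (dist_pos.2 hx) α)).2 (h x x')

theorem norm_sub_le_of_mem_lipSpace {α : ℝ} (hα : 0 < α) {K E : Type*} [MetricSpace K]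
    [NormedAddCommGroup E] [NormedSpace ℂ E] {F : C(K, E)} (h : F ∈ LipSpace α K E) (x x' : K) :
    ‖F x - F x'‖ ≤ lipNumber α F * dist x x' ^ α := by
  by_cases hx : x = x'
  · subst hx; simp [Real.zero_rpow hα.ne']
  exact (div_le_iff₀ (Real.rpow_pos_of_pos (dist_pos.2 hx) α)).1 (le_csSup h ⟨x, x', hx, rfl⟩)

theorem le_diam_rpow_mul {α : ℝ} (hα1 : α ≤ 1) {K : Type*} [MetricSpace K]
    [CompactSpace K] (x x' : K) :
    dist x x' ≤ Metric.diam (univ : Set K) ^ (1 - α) * dist x x' ^ α := by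
  rcases (dist_nonneg (x := x) (y := x')).eq_or_lt with h0 | h0
  · rw [← h0]
    exact mul_nonneg (Real.rpow_nonneg Metric.diam_nonneg _) (Real.rpow_nonneg le_rfl _)
  · calc dist x x' = dist x x' ^ (1 - α) * dist x x' ^ α := by rw [← Real.rpow_add h0]; simp
      _ ≤ _ := mul_le_mul_of_nonneg_right (Real.rpow_le_rpow h0.le
          (Metric.dist_le_diam_of_mem isCompact_univ.isBounded (mem_univ x) (mem_univ x'))
          (by linarith)) (Real.rpow_nonneg h0.le _)

variable {X Y : Type*} [MetricSpace X] [CompactSpace X] [TopologicalSpace Y] [CompactSpace Y]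

theorem isLipschitzType_lipSpace {α : ℝ} (hα : 0 < α) (hα1 : α ≤ 1) :
    IsLipschitzType α (LipSpace α X C(Y, ℂ)) where
  le_lipSpace := le_rfl
  mem_of_dominated F hF G h := mem_lipSpace_of_norm_sub_le (C := lipNumber α F) fun x x' =>
    (h x x').trans (norm_sub_le_of_mem_lipSpace hα hF x x')
  mem_of_lipschitz G C h := by
    refine mem_lipSpace_of_norm_sub_le (C := |C| * Metric.diam (univ : Set X) ^ (1 - α))
      fun x x' => (h x x').trans ?_
    rw [mul_assoc]
    exact (mul_le_mul_of_nonneg_right (le_abs_self C) dist_nonneg).trans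
      (mul_le_mul_of_nonneg_left (le_diam_rpow_mul hα1 x x') (abs_nonneg C))

theorem isLipschitzType_littleLipSpace {α : ℝ} (hα : 0 < α) (hα1 : α < 1) :
    IsLipschitzType α (LittleLipSpace α X C(Y, ℂ)) where
  le_lipSpace F hF := hF.1
  mem_of_dominated F hF G h := by
    rw [mem_littleLipSpace_iff] at hF ⊢
    refine ⟨(isLipschitzType_lipSpace hα hα1.le).mem_of_dominated F hF.1 G h, fun x₀ ε hε => ?_⟩
    filter_upwards [hF.2 x₀ ε hε] with x hx
    exact (h x₀ x).trans hx
  mem_of_lipschitz G C h := by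
    rw [mem_littleLipSpace_iff]
    refine ⟨(isLipschitzType_lipSpace hα hα1.le).mem_of_lipschitz G C h, fun x₀ ε hε => ?_⟩
    have h1 := (tendsto_dist_rpow (sub_pos.2 hα1) x₀).const_mul |C|
    rw [mul_zero] at h1
    filter_upwards [h1.eventually (gt_mem_nhds hε)] with x hx
    refine (h x₀ x).trans ?_
    rcases (dist_nonneg (x := x₀) (y := x)).eq_or_lt with h0 | h0
    · rw [← h0, mul_zero]
      exact mul_nonneg hε.le (Real.rpow_nonneg le_rfl _)
    · calc C * dist x₀ x ≤ |C| * dist x₀ x := mul_le_mul_of_nonneg_right (le_abs_self C) h0.le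
        _ = |C| * dist x₀ x ^ (1 - α) * dist x₀ x ^ α := by
            rw [mul_assoc, ← Real.rpow_add h0]; simp
        _ ≤ ε * dist x₀ x ^ α := mul_le_mul_of_nonneg_right hx.le (Real.rpow_nonneg h0.le _)

/-- A cone of height `δ ^ α` and radius `δ` around `c`. -/
noncomputable def bump (α δ : ℝ) (c x : X) : ℝ := max 0 (δ ^ α - δ ^ (α - 1) * dist x c)

theorem bump_nonneg (α δ : ℝ) (c x : X) : 0 ≤ bump α δ c x := le_max_left _ _

theorem bump_le {α δ : ℝ} (hδ : 0 < δ) (c x : X) : bump α δ c x ≤ δ ^ α :=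
  max_le (Real.rpow_nonneg hδ.le _) (by
    have := mul_nonneg (Real.rpow_nonneg hδ.le (α - 1)) (dist_nonneg (x := x) (y := c))
    linarith)

theorem bump_self {α δ : ℝ} (hδ : 0 < δ) (c : X) : bump α δ c c = δ ^ α := by
  rw [bump, dist_self, mul_zero, sub_zero, max_eq_right (Real.rpow_nonneg hδ.le _)]

theorem rpow_sub_one_mul {α δ : ℝ} (hδ : 0 < δ) : δ ^ (α - 1) * δ = δ ^ α := by
  nth_rewrite 2 [← Real.rpow_one δ]
  rw [← Real.rpow_add hδ]; simp

theorem bump_eq_zero {α δ : ℝ} (hδ : 0 < δ) {c x : X} (h : δ ≤ dist x c) : bump α δ c x = 0 := by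
  refine max_eq_left ?_
  have := mul_le_mul_of_nonneg_left h (Real.rpow_nonneg hδ.le (α - 1))
  rw [rpow_sub_one_mul hδ] at this
  linarith

theorem bump_le_add {α δ : ℝ} (hδ : 0 < δ) (c x x' : X) :
    bump α δ c x ≤ bump α δ c x' + δ ^ (α - 1) * dist x x' := by
  have h0 := Real.rpow_nonneg hδ.le (α - 1)
  refine max_le (add_nonneg (bump_nonneg _ _ _ _) (mul_nonneg h0 dist_nonneg)) ?_
  have h1 : δ ^ α - δ ^ (α - 1) * dist x' c ≤ bump α δ c x' := le_max_right _ _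
  have h2 : dist x' c ≤ dist x x' + dist x c := by
    rw [dist_comm x x']; exact dist_triangle _ _ _
  nlinarith

/-- The constant 1 is independent of δ, so suprema of cones inherit it. At distance at least δ the
height δ^α suffices; below δ the slope δ^(α-1) is at most d(x, x')^(α-1). -/
theorem bump_le_add_rpow {α δ : ℝ} (hα : 0 < α) (hα1 : α ≤ 1) (hδ : 0 < δ) (c x x' : X) :
    bump α δ c x ≤ bump α δ c x' + dist x x' ^ α := by
  rcases (dist_nonneg (x := x) (y := x')).eq_or_lt with h0 | h0
  · have : x = x' := dist_eq_zero.1 h0.symm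
    subst this
    simp [Real.zero_rpow hα.ne']
  rcases le_total δ (dist x x') with h | h
  · have h1 := bump_le (α := α) hδ c x
    have h2 := Real.rpow_le_rpow hδ.le h hα.le
    linarith [bump_nonneg α δ c x']
  · refine (bump_le_add hδ c x x').trans (add_le_add_right ?_ _)
    rw [← rpow_sub_one_mul h0]
    exact mul_le_mul_of_nonneg_right (Real.rpow_le_rpow_of_nonpos h0 h (by linarith)) h0.le

/-- A little Lipschitz function that is not uniformly little Lipschitz along given sequences. -/
theorem exists_littleLip_not_uniform {α : ℝ} (hα : 0 < α) (hα1 : α < 1) {p : X} {c q : ℕ → X}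
    (hc : ∀ n, 0 < dist (c n) p) (hc1 : ∀ n, dist (c n) p ≤ 1)
    (hc2 : ∀ n, dist (c (n + 1)) p ≤ dist (c n) p / 2)
    (hq : ∀ n, 0 < dist (q n) (c n)) (hqc : ∀ n, dist (q n) (c n) ≤ dist (c n) p ^ 2 / 8) :
    ∃ g : X → ℝ, (∀ x x', |g x - g x'| ≤ dist x x' ^ α) ∧
      (∀ x₀, ∀ ε > 0, ∀ᶠ x in 𝓝 x₀, |g x₀ - g x| ≤ ε * dist x₀ x ^ α) ∧
      ∀ n, dist (q n) (c n) ^ α ≤ |g (c n) - g (q n)| := by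
  set d : ℕ → ℝ := fun n => dist (c n) p with hd
  set δ : ℕ → ℝ := fun n => dist (q n) (c n) with hδ
  have hδd : ∀ n, δ n ≤ d n / 8 := fun n => by
    have h1 := hqc n
    have h2 : d n ^ 2 ≤ d n := by nlinarith [hc n, hc1 n]
    change δ n ≤ d n ^ 2 / 8 at h1
    linarith
  have hδ1 : ∀ n, δ n ≤ 1 := fun n => by
    have h1 := hδd n
    have h2 : d n ≤ 1 := hc1 n
    linarith
  have hhalf : ∀ m n, m < n → d n ≤ d m / 2 := by
    intro m n hmn
    induction n, hmn using Nat.le_induction with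
    | base => exact hc2 m
    | succ n _ ih =>
      have h1 := hc2 n
      have h2 := hc n
      change d (n + 1) ≤ d n / 2 at h1
      change 0 < d n at h2
      linarith
  have hpow : ∀ n, d n ≤ (1 / 2) ^ n := by
    intro n
    induction n with
    | zero => simpa using hc1 0
    | succ n ih =>
      have h1 := hc2 n
      change d (n + 1) ≤ d n / 2 at h1
      rw [pow_succ]; linarith
  have hd0 : Tendsto d atTop (𝓝 0) :=
    squeeze_zero (fun n => dist_nonneg) hpow
      (tendsto_pow_atTop_nhds_zero_of_lt_one (by norm_num) (by norm_num))
  let b : ℕ → X → ℝ := fun n x => bump α (δ n) (c n) x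
  have hb1 : ∀ x n, b n x ≤ 1 := fun x n =>
    (bump_le (hq n) _ _).trans (Real.rpow_le_one (hq n).le (hδ1 n) hα.le)
  have hbdd : ∀ x, BddAbove (range fun n => b n x) := fun x =>
    ⟨1, by rintro _ ⟨n, rfl⟩; exact hb1 x n⟩
  -- Cones of radius δ n around c n, where δ n = d(q n, c n): each drops from δ n ^ α to 0 over a
  -- distance δ n.
  let g : X → ℝ := fun x => ⨆ n, b n x
  have hbg : ∀ x n, b n x ≤ g x := fun x n => le_ciSup (hbdd x) n
  have hgle : ∀ x C, (∀ n, b n x ≤ C) → g x ≤ C := fun x C h => ciSup_le h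
  have hg0 : ∀ x, 0 ≤ g x := fun x => (bump_nonneg _ _ _ _).trans (hbg x 0)
  have hzero : ∀ x, (∀ n, δ n ≤ dist x (c n)) → g x = 0 := fun x h =>
    le_antisymm (hgle x 0 fun n => (bump_eq_zero (hq n) (h n)).le) (hg0 x)
  refine ⟨g, ?_, ?_, ?_⟩
  · have key : ∀ x x', g x ≤ g x' + dist x x' ^ α := fun x x' => hgle x _ fun n =>
      (bump_le_add_rpow hα hα1.le (hq n) (c n) x x').trans (add_le_add_left (hbg x' n) _)
    intro x x'
    have h1 := key x x'
    have h2 := key x' x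
    rw [dist_comm] at h2
    exact abs_le.2 ⟨by linarith, by linarith⟩
  · intro x₀ ε hε
    by_cases hx₀ : x₀ = p
    · subst hx₀
      have hgp : g x₀ = 0 := hzero x₀ fun n => by
        rw [dist_comm]
        have h1 := hδd n
        have h2 := hc n
        change δ n ≤ d n
        change 0 < d n at h2
        linarith
      -- At p, a cone that is nonzero at x has d n ≤ 2 d(p, x), hence δ n ≤ d(p, x)². So g(x) ≤ d(p,
      -- x)^(2α), which is negligible against d(p, x)^α.
      filter_upwards [(tendsto_dist_rpow hα x₀).eventually (gt_mem_nhds hε)] with x hx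
      rw [hgp, zero_sub, abs_neg, abs_of_nonneg (hg0 x)]
      refine (hgle x (dist x₀ x ^ α * dist x₀ x ^ α) fun n => ?_).trans
        (mul_le_mul_of_nonneg_right hx.le (Real.rpow_nonneg dist_nonneg _))
      rcases le_or_gt (δ n) (dist x (c n)) with h | h
      · rw [show b n x = 0 from bump_eq_zero (hq n) h]
        exact mul_self_nonneg _
      · have h1 : d n ≤ dist x (c n) + dist x₀ x := by
          rw [dist_comm x (c n), dist_comm x₀ x]; exact dist_triangle _ _ _
        have h2 := hδd n
        have h3 : d n / 2 ≤ dist x₀ x := by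
          have h2 := hc n
          change 0 < d n at h2
          linarith
        have h4 : δ n ≤ dist x₀ x * dist x₀ x := by
          have h5 := hqc n
          have h6 := hc n
          change δ n ≤ d n ^ 2 / 8 at h5
          change 0 < d n at h6
          nlinarith
        refine (bump_le (hq n) _ _).trans ?_
        rw [← Real.mul_rpow dist_nonneg dist_nonneg]
        exact Real.rpow_le_rpow (hq n).le h4 hα.le
    -- Away from p only finitely many cones matter nearby, so g is locally Lipschitz there, and α <
    -- 1 makes this enough.
    · have hρ : 0 < dist x₀ p := dist_pos.2 hx₀
      obtain ⟨N, hN⟩ := eventually_atTop.1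
        (hd0.eventually (gt_mem_nhds (show (0 : ℝ) < dist x₀ p / 4 by positivity)))
      set C := ∑ n ∈ Finset.range N, δ n ^ (α - 1) with hC
      have hC0 : 0 ≤ C := Finset.sum_nonneg fun n _ => Real.rpow_nonneg (hq n).le _
      have key : ∀ x x', dist x₀ x < dist x₀ p / 4 → g x ≤ g x' + C * dist x x' := by
        intro x x' hx
        refine hgle x _ fun n => ?_
        rcases lt_or_ge n N with hn | hn
        · refine (bump_le_add (hq n) (c n) x x').trans (add_le_add (hbg x' n) ?_)
          refine mul_le_mul_of_nonneg_right ?_ dist_nonneg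
          exact Finset.single_le_sum (f := fun n => δ n ^ (α - 1))
            (fun n _ => Real.rpow_nonneg (hq n).le _) (Finset.mem_range.2 hn)
        · have h1 := hN n hn
          have h2 : dist x₀ p ≤ dist x₀ x + dist x (c n) + d n := dist_triangle4 _ _ _ _
          have h3 := hδd n
          have h4 : 0 < d n := hc n
          rw [show b n x = 0 from bump_eq_zero (hq n)
            (by change δ n ≤ _; linarith)]
          exact add_nonneg (hg0 _) (mul_nonneg hC0 dist_nonneg)
      have h1 := (tendsto_dist_rpow (sub_pos.2 hα1) x₀).const_mul C
      rw [mul_zero] at h1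
      filter_upwards [h1.eventually (gt_mem_nhds hε),
        Metric.ball_mem_nhds x₀ (show (0 : ℝ) < dist x₀ p / 4 by positivity)] with x hx hxb
      have h2 := key x₀ x (by rw [dist_self]; positivity)
      have h3 := key x x₀ (by rw [dist_comm]; exact hxb)
      rw [dist_comm x x₀] at h3
      refine (abs_le.2 (⟨by linarith, by linarith⟩ :
        -(C * dist x₀ x) ≤ g x₀ - g x ∧ g x₀ - g x ≤ C * dist x₀ x)).trans ?_
      rcases (dist_nonneg (x := x₀) (y := x)).eq_or_lt with h0 | h0
      · rw [← h0, mul_zero]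
        exact mul_nonneg hε.le (Real.rpow_nonneg le_rfl _)
      · calc C * dist x₀ x = C * dist x₀ x ^ (1 - α) * dist x₀ x ^ α := by
              rw [mul_assoc, ← Real.rpow_add h0]; simp
          _ ≤ ε * dist x₀ x ^ α := mul_le_mul_of_nonneg_right hx.le (Real.rpow_nonneg h0.le _)
  · intro n
    -- The point q n lies on the rim of its own cone; it is outside the others because the distances
    -- d n halve while δ n ≤ d n / 8.
    have h0 : g (q n) = 0 := hzero _ fun m => by
      rcases lt_trichotomy m n with h | h | h
      · have h1 := hhalf m n h
        have h2 : d m ≤ dist (q n) (c m) + (δ n + d n) := by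
          have h3 := dist_triangle4 (c m) (q n) (c n) p
          rw [dist_comm (c m) (q n)] at h3
          change d m ≤ _ + δ n + d n at h3
          linarith
        have h3 := hδd n
        have h4 := hδd m
        have h5 : 0 < d m := hc m
        linarith
      · rw [h]
      · have h1 := hhalf n m h
        have h2 : d n ≤ δ n + dist (q n) (c m) + d m := by
          have h3 := dist_triangle4 (c n) (q n) (c m) p
          rw [dist_comm (c n) (q n)] at h3
          exact h3
        have h3 := hδd n
        have h4 := hδd m
        have h5 : 0 < d n := hc n
        have h6 : 0 < d m := hc m
        linarith
    have h1 : δ n ^ α ≤ g (c n) := (bump_self (hq n) (c n)).symm.trans_le (hbg (c n) n)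
    rw [h0, sub_zero]
    exact h1.trans (le_abs_self _)

/-- A real function on `X`, as a complex map that is constant in `Y`. -/
noncomputable def constSnd {X : Type*} (Y : Type*) [TopologicalSpace X] [TopologicalSpace Y]
    (g : C(X, ℝ)) : C(X, C(Y, ℂ)) :=
  ContinuousMap.comp ⟨fun z : ℂ => ContinuousMap.const Y z, ContinuousMap.continuous_const'⟩
    ⟨fun x => (g x : ℂ), by fun_prop⟩

@[simp] theorem constSnd_apply {X Y : Type*} [TopologicalSpace X] [TopologicalSpace Y]
    (g : C(X, ℝ)) (x : X) (y : Y) : constSnd Y g x y = (g x : ℂ) := rfl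

theorem norm_constSnd_sub_le (g : C(X, ℝ)) (x x' : X) :
    ‖constSnd Y g x - constSnd Y g x'‖ ≤ |g x - g x'| := by
  rw [ContinuousMap.norm_le _ (abs_nonneg _)]
  intro y
  rw [ContinuousMap.sub_apply, constSnd_apply, constSnd_apply, ← Complex.ofReal_sub,
    Complex.norm_real, Real.norm_eq_abs]

end LittleLipschitz

/-! ### Surjectivity for little Lipschitz spaces. -/

section LittleLipschitzConverse

variable {X₁ X₂ Y₁ Y₂ : Type*} [MetricSpace X₁] [CompactSpace X₁] [MetricSpace X₂] [CompactSpace X₂]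
  [TopologicalSpace Y₁] [CompactSpace Y₁] [TopologicalSpace Y₂] [CompactSpace Y₂]
  {α : ℝ} {h : C(Y₂, ℂ)} {φ : C(X₂ × Y₂, X₁)} {τ : Y₂ ≃ₜ Y₁}
  {U : LittleLipSpace α X₁ C(Y₁, ℂ) → LittleLipSpace α X₂ C(Y₂, ℂ)}

/-- Otherwise φ(x₀, y) takes values c n ≠ p converging to p. Some little Lipschitz g has quotients
at least 1 between c n and points q n = φ(z n, y n) with z n → x₀. Its image under U then has
quotients at least 1 between x₀ and z n, so it is not little Lipschitz at x₀. -/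
theorem eventually_eq_of_form (hα : 0 < α) (hα1 : α < 1) (hh : ∀ y : Y₂, ‖h y‖ = 1)
    (hφ : ∀ y : Y₂, Isometry (fun x : X₂ => φ (x, y)) ∧
      Function.Surjective (fun x : X₂ => φ (x, y)))
    (hform : ∀ (F : LittleLipSpace α X₁ C(Y₁, ℂ)) (x : X₂) (y : Y₂),
      (U F : C(X₂, C(Y₂, ℂ))) x y = h y * (F : C(X₁, C(Y₁, ℂ))) (φ (x, y)) (τ y))
    (x₀ : X₂) (y₀ : Y₂) : ∀ᶠ y in 𝓝 y₀, φ (x₀, y) = φ (x₀, y₀) := by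
  by_contra hne
  have hφd : ∀ x x' y, dist (φ (x, y)) (φ (x', y)) = dist x x' := fun x x' y => (hφ y).1.dist_eq x x'
  set p := φ (x₀, y₀) with hp
  have hY : ∀ ε : ℝ, 0 < ε → ∃ y, 0 < dist (φ (x₀, y)) p ∧ dist (φ (x₀, y)) p < ε := by
    intro ε hε
    have h1 : ∀ᶠ y in 𝓝 y₀, dist (φ (x₀, y)) p < ε := by
      have : Continuous fun y => dist (φ (x₀, y)) p := by fun_prop
      exact this.continuousAt.eventually_lt continuousAt_const (by simpa [hp] using hε)
    obtain ⟨y, hy, hy'⟩ := (Filter.not_eventually.1 hne).and_eventually h1 |>.exists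
    exact ⟨y, dist_pos.2 hy, hy'⟩
  -- Since φ(·, y₀) is a surjective isometry, the points near p come from points near x₀, so x₀ is
  -- not isolated.
  have hX : ∀ ε : ℝ, 0 < ε → ∃ x, 0 < dist x x₀ ∧ dist x x₀ < ε := by
    intro ε hε
    obtain ⟨y, hy, hy'⟩ := hY ε hε
    obtain ⟨x, hx⟩ := (hφ y₀).2 (φ (x₀, y))
    have : dist x x₀ = dist (φ (x₀, y)) p := by rw [← hφd x x₀ y₀]; exact congrArg (dist · p) hx
    exact ⟨x, this ▸ hy, this ▸ hy'⟩
  have : Nonempty Y₂ := ⟨y₀⟩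
  have : Nonempty X₂ := ⟨x₀⟩
  choose! y hy0 hyε using hY
  choose! z hz0 hzε using hX
  -- Each tolerance is half the distance reached before, which yields the halving of d(c n, p).
  let e : ℕ → ℝ := fun n => Nat.rec 1 (fun _ t => dist (φ (x₀, y t)) p / 2) n
  have he1 : ∀ n, e (n + 1) = dist (φ (x₀, y (e n))) p / 2 := fun n => rfl
  have he : ∀ n, 0 < e n := by
    intro n
    induction n with
    | zero => exact one_pos
    | succ n ih => rw [he1]; exact half_pos (hy0 _ ih)
  have he_le : ∀ n, e n ≤ 1 := by
    intro n
    induction n with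
    | zero => exact le_rfl
    | succ n ih => rw [he1]; linarith [hyε _ (he n), hy0 _ (he n)]
  let c : ℕ → X₁ := fun n => φ (x₀, y (e n))
  have hc0 : ∀ n, 0 < dist (c n) p := fun n => hy0 _ (he n)
  let r : ℕ → ℝ := fun n => dist (c n) p ^ 2 / 8
  have hr : ∀ n, 0 < r n := fun n => by have := hc0 n; positivity
  let q : ℕ → X₁ := fun n => φ (z (r n), y (e n))
  have hqc : ∀ n, dist (q n) (c n) = dist (z (r n)) x₀ := fun n => hφd _ _ _
  have hc1 : ∀ n, dist (c n) p ≤ 1 := fun n => (hyε _ (he n)).le.trans (he_le n)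
  have hc2 : ∀ n, dist (c (n + 1)) p ≤ dist (c n) p / 2 := fun n => (hyε _ (he (n + 1))).le
  obtain ⟨g, hg, hgl, hgq⟩ := exists_littleLip_not_uniform hα hα1 hc0 hc1 hc2
    (fun n => (hqc n).symm ▸ hz0 _ (hr n)) (fun n => (hqc n).symm ▸ (hzε _ (hr n)).le)
  have hgc : Continuous g := by
    rw [continuous_iff_continuousAt]
    intro a
    rw [ContinuousAt, tendsto_iff_dist_tendsto_zero]
    refine squeeze_zero (fun x => dist_nonneg) (fun x => ?_) (tendsto_dist_rpow hα a)
    rw [Real.dist_eq, dist_comm]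
    exact hg x a
  have hF : constSnd Y₁ ⟨g, hgc⟩ ∈ LittleLipSpace α X₁ C(Y₁, ℂ) := by
    rw [mem_littleLipSpace_iff]
    refine ⟨mem_lipSpace_of_norm_sub_le (C := 1) fun x x' => ?_, fun a ε hε => ?_⟩
    · rw [one_mul]
      exact (norm_constSnd_sub_le _ x x').trans (hg x x')
    · filter_upwards [hgl a ε hε] with x hx
      exact (norm_constSnd_sub_le _ a x).trans hx
  have hUF := ((mem_littleLipSpace_iff.1 (U ⟨_, hF⟩).2).2 x₀ (1 / 2) (by norm_num))
  have hpow : ∀ n, dist (c n) p ≤ (1 / 2) ^ n := by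
    intro n
    induction n with
    | zero => simpa using hc1 0
    | succ n ih => rw [pow_succ]; linarith [hc2 n]
  have hz : Tendsto (fun n => z (r n)) atTop (𝓝 x₀) := by
    rw [tendsto_iff_dist_tendsto_zero]
    refine squeeze_zero (fun n => dist_nonneg) (fun n => ?_)
      (tendsto_pow_atTop_nhds_zero_of_lt_one (r := (1 / 2 : ℝ)) (by norm_num) (by norm_num))
    refine (hzε _ (hr n)).le.trans (le_trans ?_ (hpow n))
    change dist (c n) p ^ 2 / 8 ≤ _
    nlinarith [hc1 n, hc0 n]
  obtain ⟨n, hn⟩ := (hz.eventually hUF).exists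
  have h1 := (ContinuousMap.norm_coe_le_norm _ (y (e n))).trans hn
  rw [ContinuousMap.sub_apply, hform, hform, ← mul_sub, norm_mul, hh, one_mul, constSnd_apply,
    constSnd_apply, ← Complex.ofReal_sub, Complex.norm_real, Real.norm_eq_abs] at h1
  have h2 := (hgq n).trans h1
  rw [hqc, dist_comm x₀] at h2
  have h3 := Real.rpow_pos_of_pos (hz0 _ (hr n)) α
  linarith

/-- Local constancy passes from φ to ψ. On the compact Y₂ the function ψ(a, ·) then has finite
range, so the limits of W at these base points are uniform in y. -/
theorem pullback_mem_littleLipSpace (hh : ∀ y : Y₂, ‖h y‖ = 1)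
    {ψ : C(X₁ × Y₂, X₂)} (hφψ : ∀ a y, φ (ψ (a, y), y) = a) (hψφ : ∀ x y, ψ (φ (x, y), y) = x)
    (hψ : ∀ a a' y, dist (ψ (a, y)) (ψ (a', y)) = dist a a')
    (hloc : ∀ x₀ y₀, ∀ᶠ y in 𝓝 y₀, φ (x₀, y) = φ (x₀, y₀))
    {W : C(X₂, C(Y₂, ℂ))} (hW : W ∈ LittleLipSpace α X₂ C(Y₂, ℂ)) :
    pullback h ψ τ W ∈ LittleLipSpace α X₁ C(Y₁, ℂ) := by
  rw [mem_littleLipSpace_iff] at hW ⊢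
  refine ⟨pullback_mem_lipSpace hh hψ hW.1, fun a ε hε => ?_⟩
  have hψloc : ∀ y₀, ∀ᶠ y in 𝓝 y₀, ψ (a, y) = ψ (a, y₀) := by
    intro y₀
    filter_upwards [hloc (ψ (a, y₀)) y₀] with y hy
    rw [hφψ] at hy
    rw [← hψφ (ψ (a, y₀)) y, hy]
  have hfin : (range fun y => ψ (a, y)).Finite := by
    have hlc : IsLocallyConstant fun y => ψ (a, y) := (IsLocallyConstant.iff_eventually_eq _).2 hψloc
    exact hlc.range_finite
  -- The second point ψ(a', y) also varies with y; only its distance d(a, a') to ψ(a, y) is common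
  -- to all y, so the estimate is phrased in terms of that distance.
  have hev : ∀ᶠ d in 𝓝[≥] (0 : ℝ), ∀ x ∈ range fun y => ψ (a, y), ∀ x', dist x x' = d →
      ‖W x - W x'‖ ≤ ε * dist x x' ^ α := by
    rw [Filter.eventually_all_finite hfin]
    intro x _
    obtain ⟨ρ, hρ, hball⟩ := Metric.eventually_nhds_iff.1 (hW.2 x ε hε)
    filter_upwards [mem_nhdsWithin_of_mem_nhds (Iio_mem_nhds hρ)] with d hd x' hx'
    exact hball (by rw [dist_comm, hx']; exact hd)
  have htend : Tendsto (fun a' => dist a a') (𝓝 a) (𝓝[≥] 0) := by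
    refine tendsto_nhdsWithin_iff.2 ⟨?_, Eventually.of_forall fun _ => dist_nonneg⟩
    have : Continuous fun a' => dist a a' := by fun_prop
    simpa using this.tendsto a
  filter_upwards [htend.eventually hev] with a' ha'
  rw [ContinuousMap.norm_le _ (mul_nonneg hε.le (Real.rpow_nonneg dist_nonneg _))]
  intro b
  obtain ⟨y, rfl⟩ := τ.surjective b
  rw [ContinuousMap.sub_apply, norm_pullback_sub hh]
  have h1 := ha' _ ⟨y, rfl⟩ (ψ (a', y)) (hψ a a' y)
  rw [hψ] at h1
  exact (ContinuousMap.norm_coe_le_norm (W (ψ (a, y)) - W (ψ (a', y))) y).trans h1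

end LittleLipschitzConverse

theorem corollary8p1 {X₁ X₂ Y₁ Y₂ : Type*}
    [MetricSpace X₁] [CompactSpace X₁] [Nonempty X₁]
    [MetricSpace X₂] [CompactSpace X₂] [Nonempty X₂]
    [TopologicalSpace Y₁] [CompactSpace Y₁] [T2Space Y₁]
    [TopologicalSpace Y₂] [CompactSpace Y₂] [T2Space Y₂] :
    (∀ U : LipSpace 1 X₁ C(Y₁, ℂ) → LipSpace 1 X₂ C(Y₂, ℂ),
      IsSurjectiveSumNormIsometry 1 (LipSpace 1 X₁ C(Y₁, ℂ)) (LipSpace 1 X₂ C(Y₂, ℂ)) U ↔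
        ∃ (h : C(Y₂, ℂ)) (φ : C(X₂ × Y₂, X₁)) (τ : Y₂ ≃ₜ Y₁),
          (∀ y : Y₂, ‖h y‖ = 1) ∧
          (∀ y : Y₂, Isometry (fun x : X₂ => φ (x, y)) ∧
            Function.Surjective (fun x : X₂ => φ (x, y))) ∧
          ∀ (F : LipSpace 1 X₁ C(Y₁, ℂ)) (x : X₂) (y : Y₂),
            (U F : C(X₂, C(Y₂, ℂ))) x y =
              h y * (F : C(X₁, C(Y₁, ℂ))) (φ (x, y)) (τ y)) ∧
    (∀ α : ℝ, 0 < α → α < 1 →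
      ∀ U : LittleLipSpace α X₁ C(Y₁, ℂ) → LittleLipSpace α X₂ C(Y₂, ℂ),
        IsSurjectiveSumNormIsometry α
            (LittleLipSpace α X₁ C(Y₁, ℂ)) (LittleLipSpace α X₂ C(Y₂, ℂ)) U ↔
          ∃ (h : C(Y₂, ℂ)) (φ : C(X₂ × Y₂, X₁)) (τ : Y₂ ≃ₜ Y₁),
            (∀ y : Y₂, ‖h y‖ = 1) ∧
            (∀ y : Y₂, Isometry (fun x : X₂ => φ (x, y)) ∧
              Function.Surjective (fun x : X₂ => φ (x, y))) ∧
            ∀ (F : LittleLipSpace α X₁ C(Y₁, ℂ)) (x : X₂) (y : Y₂),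
              (U F : C(X₂, C(Y₂, ℂ))) x y =
                h y * (F : C(X₁, C(Y₁, ℂ))) (φ (x, y)) (τ y)) := by

  refine ⟨fun U => ⟨fun hU => ?_, ?_⟩, fun α hα hα1 U => ⟨fun hU => ?_, ?_⟩⟩
  · exact exists_weighted_composition_form one_pos le_rfl
      (isLipschitzType_lipSpace one_pos le_rfl) (isLipschitzType_lipSpace one_pos le_rfl) hU
  · rintro ⟨h, φ, τ, hh, hφ, hform⟩
    obtain ⟨ψ, hφψ, hψφ⟩ := exists_fiberwise_inverse hφ
    have hψ := dist_fiberwise_inverse hφ hφψ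
    refine ⟨isLinearMap_of_form hform, fun W => ?_,
      sumNorm_eq_of_form le_rfl le_rfl hh hφ hform⟩
    exact ⟨⟨pullback h ψ τ W, pullback_mem_lipSpace hh hψ W.2⟩, map_pullback hh hψφ hform W _⟩
  · exact exists_weighted_composition_form hα hα1.le
      (isLipschitzType_littleLipSpace hα hα1) (isLipschitzType_littleLipSpace hα hα1) hU
  · rintro ⟨h, φ, τ, hh, hφ, hform⟩
    obtain ⟨ψ, hφψ, hψφ⟩ := exists_fiberwise_inverse hφ
    have hψ := dist_fiberwise_inverse hφ hφψ
    have hloc := eventually_eq_of_form hα hα1 hh hφ hform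
    refine ⟨isLinearMap_of_form hform, fun W => ?_,
      sumNorm_eq_of_form (fun F hF => hF.1) (fun F hF => hF.1) hh hφ hform⟩
    exact ⟨⟨pullback h ψ τ W, pullback_mem_littleLipSpace hh hφψ hψφ hψ hloc W.2⟩,
      map_pullback hh hψφ hform W _⟩
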